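/- For a Boolean function $f$ of $n$ variables with exactly $k$ zeros, a zero matrix $M_f\in\{0,1\}^{k\times n}$ is a matrix whose rows are all the zeros of $f$, each listed once. Call $f$ reduced if the columns of $M_f$ are non-constant and pairwise distinct, and no column is the negation of a column. Let $P_k^n$ be the class of Boolean functions of $n$ variables with exactly $k$ zeros. A complete function $\phi_k$ is a reduced function in $P_k^{2^{k-1}-1}$. The weight of a vector in $\{0,1\}^k$ is the minimum of its number of ones and its number of zeros. For a Boolean function $f$ let $L(f)$ be the number of literal occurrences in a minimal DNF of $f$, i.e. the minimum, over all disjunctive normal forms of $f$, of the total number of literals in its conjunctions. For $k\ge 1$ let $h_k$ be a reduced Boolean function with $k$ zeros whose zero matrix $H_k$ has the largest possible number $n_k$ of columns among all zero matrices of reduced functions with $k$ zeros all of whose columns have weight at least $k/2-\sqrt{k\ln k}$. Such functions $h_k$ and complete functions $\phi_k$ exist for every $k\ge1$, and for every choice of them: 1. For every $k\ge 1$, $n_k\ge 2^{k-1}\left(1-\frac2k\right)$. 2. For every $k\ge1$ with $\frac{2\sqrt{k\ln k}}{k}\le\frac14$, $$L(h_k)>2^{k-1}\left(\frac{10}{3}-\frac53\cdot\frac{2\ln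 k}{\sqrt k+2\ln k}\right)\left(1-\frac2k\right),$$ and there is a sequence $\delta_k\to0$, independent of the choice of $h_k$, with $L(h_k)>\frac{10}{3}\cdot2^{k-1}(1+\delta_k)$ for all $k\ge1$. 3. There is a sequence $\delta_k\to0$, independent of the choice of $\phi_k$, with $L(\phi_k)\le 3\cdot2^{k-1}(1+\delta_k)$ for all $k\ge1$. 4. For every real $c<\frac{10}{9}$ and all sufficiently large $k$ (depending only on $c$), $L(h_k)>c\,L(\phi_k)$ for every choice of $h_k$ and $\phi_k$. 5. The complete function is not (even asymptotically) the most complex function in its class $P_k^{2^{k-1}-1}$: there are a sequence $\delta_k\to 0$ and functions $g_k\in P_k^{2^{k-1}-1}$ with $L(g_k)>\frac{10}{3}\cdot2^{k-1}(1+\delta_k)$ for all $k\ge1$; and for every real $c<\frac{10}{9}$ and all sufficiently large $k$ there is $g\in P_k^{2^{k-1}-1}$ with $L(g)>c\,L(\phi_k)$ for every complete function $\phi_k$. -/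

import Mathlib

open Filter Topology

/-- A Boolean function of `n` variables. -/
abbrev BoolFn (n : ℕ) : Type := (Fin n → Bool) → Bool

/-- A literal: `(j, true)` is the variable `x_j`, `(j, false)` is its negation. -/
abbrev Lit (n : ℕ) : Type := Fin n × Bool

/-- A conjunction, as the set of its literals. -/
abbrev Conj (n : ℕ) : Type := Finset (Lit n)

/-- A disjunctive normal form, as the set of its conjunctions. -/
abbrev DNF (n : ℕ) : Type := Finset (Conj n)

/-- The conjunction takes the value `1` at the point `x`. -/
def Conj.Holds {n : ℕ} (K : Conj n) (x : Fin n → Bool) : Prop :=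
  ∀ l ∈ K, x l.1 = l.2

/-- An elementary conjunction does not contain a variable together with its negation. -/
def Conj.IsElementary {n : ℕ} (K : Conj n) : Prop :=
  ∀ j : Fin n, ¬ ((j, true) ∈ K ∧ (j, false) ∈ K)

/-- The number of literals that occur in a DNF. -/
def DNF.rank {n : ℕ} (D : DNF n) : ℕ := ∑ K ∈ D, K.card

/-- `D` is a DNF, made of elementary conjunctions, of the function `f`. -/
def DNF.Realizes {n : ℕ} (D : DNF n) (f : BoolFn n) : Prop :=
  (∀ K ∈ D, Conj.IsElementary K) ∧ ∀ x, f x = true ↔ ∃ K ∈ D, Conj.Holds K x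

/-- Every Boolean function has a DNF, so that the minimum below is over a non-empty set. -/
theorem exists_dnf_realizes {n : ℕ} (f : BoolFn n) : ∃ D : DNF n, DNF.Realizes D f := by
  classical
  refine ⟨(Finset.univ.filter fun x => f x = true).image
    fun x => Finset.univ.image fun j => (j, x j), ?_, ?_⟩
  · intro K hK j h
    simp only [Finset.mem_image, Finset.mem_filter, Finset.mem_univ, true_and] at hK
    obtain ⟨x, -, rfl⟩ := hK
    simp only [Finset.mem_image, Finset.mem_univ, true_and, Prod.mk.injEq] at h
    obtain ⟨⟨a, rfl, h1⟩, ⟨b, hb, h2⟩⟩ := h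
    subst hb
    simp [h1] at h2
  · intro x
    constructor
    · intro hx
      refine ⟨Finset.univ.image fun j => (j, x j), ?_, ?_⟩
      · exact Finset.mem_image.2 ⟨x, by simpa using hx, rfl⟩
      · intro l hl
        simp only [Finset.mem_image, Finset.mem_univ, true_and] at hl
        obtain ⟨j, rfl⟩ := hl
        rfl
    · rintro ⟨K, hK, h⟩
      simp only [Finset.mem_image, Finset.mem_filter, Finset.mem_univ, true_and] at hK
      obtain ⟨y, hy, rfl⟩ := hK
      have : x = y := by
        funext j
        exact h (j, y j) (Finset.mem_image.2 ⟨j, Finset.mem_univ _, rfl⟩)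
      rw [this]
      exact hy

/-- The number of literals in a minimal DNF of `f`. -/
noncomputable def minRank {n : ℕ} (f : BoolFn n) : ℕ :=
  sInf {r : ℕ | ∃ D : DNF n, DNF.Realizes D f ∧ DNF.rank D = r}

/-- `zeroClass k n`: the Boolean functions of `n` variables with exactly `k` zeros. -/
def zeroClass (k n : ℕ) : Set (BoolFn n) :=
  {f | (Finset.univ.filter fun x => f x = false).card = k}

/-- `M` is a zero matrix of `f`: its rows are all the zeros of `f`, each listed once. -/
def IsZeroMatrix {k n : ℕ} (M : Matrix (Fin k) (Fin n) Bool) (f : BoolFn n) : Prop :=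
  Function.Injective (fun i => M i) ∧ ∀ x, f x = false ↔ ∃ i, M i = x

/-- The columns of `M` are non-constant, pairwise distinct, and none is the negation of one
of them. -/
structure HasReducedColumns {k n : ℕ} (M : Matrix (Fin k) (Fin n) Bool) : Prop where
  exists_one : ∀ j, ∃ i, M i j = true
  exists_zero : ∀ j, ∃ i, M i j = false
  distinct : ∀ j j', j ≠ j' → ∃ i, M i j ≠ M i j'
  not_negation : ∀ j j', ∃ i, M i j ≠ !(M i j')

/-- A complete function: a reduced function of `2 ^ (k - 1) - 1` variables with exactly `k`
zeros. -/
def IsCompleteFn (k : ℕ) (φ : BoolFn (2 ^ (k - 1) - 1)) : Prop :=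
  ∃ M : Matrix (Fin k) (Fin (2 ^ (k - 1) - 1)) Bool, IsZeroMatrix M φ ∧ HasReducedColumns M

/-- The weight of a Boolean vector: the minimum of its numbers of ones and of zeros. -/
def weight {k : ℕ} (v : Fin k → Bool) : ℕ :=
  min (Finset.univ.filter fun i => v i = true).card
    (Finset.univ.filter fun i => v i = false).card

/-- `M` has distinct rows, reduced columns, and every column has weight at least
`k / 2 - √(k ln k)`. -/
structure IsBalanced {k n : ℕ} (M : Matrix (Fin k) (Fin n) Bool) : Prop where
  rows : Function.Injective (fun i => M i)
  columns : HasReducedColumns M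
  weight_ge : ∀ j, (k : ℝ) / 2 - √((k : ℝ) * Real.log k) ≤ (weight fun i => M i j : ℕ)

/-- The zero matrix of `h` is a matrix with `k` rows which, among the matrices `M` with
`IsBalanced M`, has the largest possible number of columns. -/
def IsExtremal (k : ℕ) {n : ℕ} (h : BoolFn n) : Prop :=
  ∃ H : Matrix (Fin k) (Fin n) Bool, IsZeroMatrix H h ∧ IsBalanced H ∧
    ∀ (n' : ℕ) (H' : Matrix (Fin k) (Fin n') Bool), IsBalanced H' → n' ≤ n

/-! Identify a literal with the set of zeros (rows of the zero matrix) at which it is false;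
opposite literals have complementary sets. Every conjunction of a DNF must then cover all rows.

Lower bound. If no two zeros differ in just one variable, changing one entry of a zero gives a point
where the function is 1. Hence each row of each set is covered by that set alone in some
conjunction. Let all sets have nearly k/2 rows. A literal that occurs once has, in its only
conjunction, at least two companions, whose sets are all disjoint from its own; so each companion is
alone there on very few rows and needs other occurrences as well. Counting incidences
(`IsPrivateCover.le_sum_card`) gives about 5/3 occurrences per literal, that is 10/3 per variable.
Chernoff's bound shows that almost all of the 2^(k-1) columns, up to negation, are balanced
(`le_card_balancedColumns`); so many columns also exclude rows that differ in one place
(`HasReducedColumns.eq_of_agree`).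

Upper bound. For a complete function the literals correspond exactly to the proper non-empty sets of
rows, and a point chooses from each complementary pair the set whose literal is true. Conjunctions
of three literals, with sets A, {c} and the rest, propagate this choice from a set to a set larger
by one row (`IsEdgeCover.isCoverSystem`). One such partition serves two sets, so about 2^(k-1) of
them suffice; the pairing comes from Hall's theorem (`exists_isEdgeCover`).

Padding with zero columns moves the balanced function into the class of the complete one without
lowering its rank. -/

/-! ### Counting occurrences in private covers. -/

/-- A family `D` of sets of indices whose sets `A l` cover everything, in such a way that each
point of each `A l` is covered by `A l` alone in some member of `D`. -/
structure IsPrivateCover {Ω Λ : Type*} [Fintype Ω] [DecidableEq Ω]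
    (A : Λ → Finset Ω) (D : Finset (Finset Λ)) : Prop where
  cover : ∀ K ∈ D, ∀ i, ∃ l ∈ K, i ∈ A l
  alone : ∀ l, ∀ i ∈ A l, ∃ K ∈ D, l ∈ K ∧ ∀ l' ∈ K, l' ≠ l → i ∉ A l'
  ne_compl : ∀ K ∈ D, ∀ l ∈ K, ∀ l' ∈ K, A l' ≠ (A l)ᶜ
  nonempty : ∀ l, (A l).Nonempty
  ne_univ : ∀ l, A l ≠ Finset.univ

/-- The points of `A l` that no other `A l'` with `l' ∈ K` covers. -/
def aloneIn {Ω Λ : Type*} [DecidableEq Ω] [DecidableEq Λ] (A : Λ → Finset Ω) (K : Finset Λ)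
    (l : Λ) : Finset Ω :=
  (A l).filter fun i => ∀ l' ∈ K, l' ≠ l → i ∉ A l'

theorem mem_aloneIn {Ω Λ : Type*} [DecidableEq Ω] [DecidableEq Λ] {A : Λ → Finset Ω}
    {K : Finset Λ} {l : Λ} {i : Ω} :
    i ∈ aloneIn A K l ↔ i ∈ A l ∧ ∀ l' ∈ K, l' ≠ l → i ∉ A l' :=
  Finset.mem_filter

namespace IsPrivateCover

variable {Ω Λ : Type*} [Fintype Ω] [DecidableEq Ω] {A : Λ → Finset Ω} {D : Finset (Finset Λ)}

theorem disjoint_of_unique (h : IsPrivateCover A D) {l : Λ} {K : Finset Λ}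
    (hK : ∀ K' ∈ D, l ∈ K' → K' = K) {l' : Λ} (hl' : l' ∈ K) (hne : l' ≠ l) :
    Disjoint (A l) (A l') := by
  rw [Finset.disjoint_left]
  intro i hi
  obtain ⟨K', hK', hl, hp⟩ := h.alone l i hi
  obtain rfl := hK K' hK' hl
  exact hp l' hl' hne

/-- With only two members, the sets of `l₁` and `l` would be disjoint and cover everything, hence
complementary. -/
theorem exists_third (h : IsPrivateCover A D) {l₁ l : Λ} {K : Finset Λ} (hKD : K ∈ D)
    (hl₁ : l₁ ∈ K) (hK : ∀ K' ∈ D, l₁ ∈ K' → K' = K) (hl : l ∈ K) (hne : l ≠ l₁) :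
    ∃ l₂ ∈ K, l₂ ≠ l ∧ l₂ ≠ l₁ := by
  by_contra! hcon
  apply h.ne_compl K hKD l₁ hl₁ l hl
  ext i
  rw [Finset.mem_compl]
  constructor
  · intro hi hi'
    exact Finset.disjoint_left.1 (h.disjoint_of_unique hK hl hne) hi' hi
  · intro hi
    obtain ⟨l₂, hl₂, hi₂⟩ := h.cover K hKD i
    by_cases h2 : l₂ = l
    · exact h2 ▸ hi₂
    · exact absurd (hcon l₂ hl₂ h2 ▸ hi₂) hi

theorem exists_second (h : IsPrivateCover A D) {l₁ : Λ} {K : Finset Λ} (hKD : K ∈ D) :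
    ∃ l ∈ K, l ≠ l₁ := by
  by_contra! hcon
  apply h.ne_univ l₁
  ext i
  obtain ⟨l, hl, hi⟩ := h.cover K hKD i
  simpa using hcon l hl ▸ hi

/-- A third member `l₂` exists, and `A l₁`, `A l₂` are disjoint sets of size at least `lo`; the
private points of `l` avoid both. -/
theorem card_alone_le [DecidableEq Λ] (h : IsPrivateCover A D) {lo : ℝ} (hlo : ∀ l, lo ≤ (A l).card)
    {l₁ l : Λ} {K : Finset Λ} (hKD : K ∈ D)
    (hl₁ : l₁ ∈ K) (hK : ∀ K' ∈ D, l₁ ∈ K' → K' = K) (hl : l ∈ K) (hne : l ≠ l₁) :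
    ((aloneIn A K l).card : ℝ) ≤
      Fintype.card Ω - 2 * lo := by
  obtain ⟨l₂, hl₂, h2, h21⟩ := h.exists_third hKD hl₁ hK hl hne
  have hd := h.disjoint_of_unique hK hl₂ h21
  have hsub : aloneIn A K l ⊆ (A l₁ ∪ A l₂)ᶜ := by
    intro i hi
    rw [mem_aloneIn] at hi
    rw [Finset.mem_compl, Finset.mem_union, not_or]
    exact ⟨hi.2 l₁ hl₁ hne.symm, hi.2 l₂ hl₂ h2⟩
  have h1 := Finset.card_le_card hsub
  have h3 : (A l₁ ∪ A l₂)ᶜ.card + ((A l₁).card + (A l₂).card) = Fintype.card Ω := by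
    rw [← Finset.card_union_of_disjoint hd, add_comm]
    exact Finset.card_add_card_compl _
  have h4 : ((A l₁ ∪ A l₂)ᶜ.card : ℝ) + ((A l₁).card + (A l₂).card) = Fintype.card Ω := by
    exact_mod_cast h3
  have h5 : ((aloneIn A K l).card : ℝ) ≤
    ((A l₁ ∪ A l₂)ᶜ.card : ℝ) := by exact_mod_cast h1
  linarith [hlo l₁, hlo l₂]

/-- The number of literals in a private cover by large sets, from below. -/
theorem le_sum_card [Fintype Λ] [DecidableEq Λ] (h : IsPrivateCover A D) {lo d : ℝ} (hlo : ∀ l, lo ≤ (A l).card)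
    (hd : d = Fintype.card Ω - 2 * lo) (hd0 : 0 ≤ d) (hdlo : d < lo) :
    (5 * lo - 4 * d) * Fintype.card Λ ≤ (3 * lo - 2 * d) * ∑ K ∈ D, (K.card : ℝ) := by
  set deg : Λ → ℕ := fun l => (D.filter fun K => l ∈ K).card with hdeg
  have hsum : ∑ K ∈ D, (K.card : ℝ) = ∑ l, (deg l : ℝ) := by
    have : ∑ K ∈ D, K.card = ∑ l, deg l := by
      simp only [hdeg, Finset.card_filter]
      rw [Finset.sum_comm]
      simp
    exact_mod_cast this
  have hdeg1 : ∀ l, 1 ≤ deg l := by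
    intro l
    obtain ⟨i, hi⟩ := h.nonempty l
    obtain ⟨K, hK, hl, -⟩ := h.alone l i hi
    exact Finset.card_pos.2 ⟨K, Finset.mem_filter.2 ⟨hK, hl⟩⟩
  -- `S` collects the literals that occur once, and `κ` below names the only conjunction of each.
  set S : Finset Λ := Finset.univ.filter fun l => deg l = 1 with hS
  have hex : ∀ l : Λ, ∃ K, l ∈ S → K ∈ D ∧ l ∈ K ∧ ∀ K' ∈ D, l ∈ K' → K' = K := by
    intro l
    by_cases hl : l ∈ S
    · obtain ⟨K, hK⟩ := Finset.card_eq_one.1 (Finset.mem_filter.1 hl).2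
      refine ⟨K, fun _ => ?_⟩
      have h1 : K ∈ D.filter fun K => l ∈ K := by rw [hK]; simp
      rw [Finset.mem_filter] at h1
      refine ⟨h1.1, h1.2, fun K' hK' hl' => ?_⟩
      have : K' ∈ D.filter fun K => l ∈ K := Finset.mem_filter.2 ⟨hK', hl'⟩
      rw [hK] at this
      simpa using this
    · exact ⟨∅, fun h => absurd h hl⟩
  choose κ hκ using hex
  -- a literal in the only conjunction of another one has degree at least two
  have hnot : ∀ l₁ ∈ S, ∀ l ∈ κ l₁, l ≠ l₁ → l ∉ S := by
    intro l₁ hl₁ l hl hne hlS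
    obtain ⟨hD, hm, hu⟩ := hκ l₁ hl₁
    have h1 := h.card_alone_le hlo hD hm hu hl hne
    obtain ⟨hD', hm', hu'⟩ := hκ l hlS
    have hκe : κ l₁ = κ l := hu' _ hD hl
    -- If `l` also occurred once, all of `A l` would be private in this one conjunction, forcing `lo
    -- ≤ d`.
    have h2 : aloneIn A (κ l₁) l = A l := by
      refine Finset.Subset.antisymm (fun i hi => (mem_aloneIn.1 hi).1)
        fun i hi => mem_aloneIn.2 ⟨hi, fun l' hl' hne' => ?_⟩
      rw [hκe] at hl'
      exact Finset.disjoint_left.1 (h.disjoint_of_unique hu' hl' hne') hi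
    rw [h2, ← hd] at h1
    linarith [hlo l]
  have hinj : Set.InjOn κ S := by
    intro l₁ h1 l₂ h2 he
    by_contra hne
    exact hnot l₁ h1 l₂ (he ▸ (hκ l₂ h2).2.1) (Ne.symm hne) h2
  -- `tdeg l` counts the conjunctions of `l` in which it accompanies a literal that occurs once.
  set tdeg : Λ → ℕ := fun l => (S.filter fun l₁ => l ∈ (κ l₁).erase l₁).card with htdeg
  have htsum : 2 * S.card ≤ ∑ l, tdeg l := by
    have : ∑ l, tdeg l = ∑ l₁ ∈ S, ((κ l₁).erase l₁).card := by
      simp only [htdeg, Finset.card_filter]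
      rw [Finset.sum_comm]
      refine Finset.sum_congr rfl fun l₁ _ => ?_
      rw [← Finset.card_filter, Finset.filter_mem_eq_inter, Finset.univ_inter]
    simp only [this]
    rw [mul_comm, ← smul_eq_mul]
    apply Finset.card_nsmul_le_sum
    intro l₁ hl₁
    obtain ⟨hD, hm, hu⟩ := hκ l₁ hl₁
    obtain ⟨l, hl, hne⟩ := h.exists_second (l₁ := l₁) hD
    obtain ⟨l₂, hl₂, h2, h21⟩ := h.exists_third hD hm hu hl hne
    exact Finset.one_lt_card.2 ⟨l, Finset.mem_erase.2 ⟨hne, hl⟩, l₂,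
      Finset.mem_erase.2 ⟨h21, hl₂⟩, h2.symm⟩
  have hmaps : ∀ l, ((S.filter fun l₁ => l ∈ (κ l₁).erase l₁).image κ) ⊆
      D.filter fun K => l ∈ K := by
    intro l K hK
    obtain ⟨l₁, hl₁, rfl⟩ := Finset.mem_image.1 hK
    rw [Finset.mem_filter] at hl₁ ⊢
    exact ⟨(hκ l₁ hl₁.1).1, Finset.mem_of_mem_erase hl₁.2⟩
  have hcardim : ∀ l, ((S.filter fun l₁ => l ∈ (κ l₁).erase l₁).image κ).card = tdeg l := by
    intro l
    exact Finset.card_image_of_injOn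
      (hinj.mono (by intro x hx; exact (Finset.mem_filter.1 hx).1))
  have htle : ∀ l, tdeg l ≤ deg l := fun l => hcardim l ▸ Finset.card_le_card (hmaps l)
  -- If all conjunctions of `l` are of this kind, each contributes at most `d` private points, and
  -- together they must exhaust `A l`.
  have hfull : ∀ l, tdeg l = deg l → lo ≤ tdeg l * d := by
    intro l hl
    have himg := Finset.eq_of_subset_of_card_le (hmaps l) (by rw [hcardim, hl])
    have hsub : A l ⊆ (S.filter fun l₁ => l ∈ (κ l₁).erase l₁).biUnion fun l₁ =>
        aloneIn A (κ l₁) l := by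
      intro i hi
      obtain ⟨K, hK, hlK, hp⟩ := h.alone l i hi
      have : K ∈ D.filter fun K => l ∈ K := Finset.mem_filter.2 ⟨hK, hlK⟩
      rw [← himg] at this
      obtain ⟨l₁, hl₁, rfl⟩ := Finset.mem_image.1 this
      exact Finset.mem_biUnion.2 ⟨l₁, hl₁, mem_aloneIn.2 ⟨hi, hp⟩⟩
    have h1 : ((A l).card : ℝ) ≤ ∑ l₁ ∈ S.filter fun l₁ => l ∈ (κ l₁).erase l₁,
        ((aloneIn A (κ l₁) l).card : ℝ) := by
      exact_mod_cast (Finset.card_le_card hsub).trans Finset.card_biUnion_le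
    have h2 : ∑ l₁ ∈ S.filter fun l₁ => l ∈ (κ l₁).erase l₁,
        ((aloneIn A (κ l₁) l).card : ℝ) ≤ tdeg l * d := by
      rw [← nsmul_eq_mul]
      apply Finset.sum_le_card_nsmul
      intro l₁ hl₁
      rw [Finset.mem_filter, Finset.mem_erase] at hl₁
      obtain ⟨hD, hm, hu⟩ := hκ l₁ hl₁.1
      rw [hd]
      exact h.card_alone_le hlo hD hm hu hl₁.2.2 hl₁.2.1
    linarith [hlo l]
  -- Either `l` has one more occurrence than `tdeg l`, or `hfull` applies.
  have hpoint : ∀ l, lo + tdeg l * (lo - d) ≤ deg l * lo := by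
    intro l
    rcases (htle l).lt_or_eq with hlt | heq
    · have h1 : (tdeg l : ℝ) + 1 ≤ deg l := by exact_mod_cast hlt
      have h2 : (0 : ℝ) ≤ tdeg l := Nat.cast_nonneg _
      nlinarith
    · have := hfull l heq
      rw [← heq]
      linarith
  have hN1 : lo * Fintype.card Λ + (∑ l, (tdeg l : ℝ)) * (lo - d) ≤ (∑ l, (deg l : ℝ)) * lo := by
    have := Finset.sum_le_sum fun l (_ : l ∈ Finset.univ) => hpoint l
    rw [Finset.sum_add_distrib, ← Finset.sum_mul, ← Finset.sum_mul, Finset.sum_const,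
      nsmul_eq_mul, Finset.card_univ] at this
    linarith
  -- Only members of `S` have degree below two. With `hN1` and `htsum` this eliminates `S.card` and
  -- the sum of `tdeg`.
  have hN2 : 2 * Fintype.card Λ ≤ ∑ l, deg l + S.card := by
    have h1 : ∑ _l : Λ, 2 ≤ ∑ l, (deg l + if deg l = 1 then 1 else 0) := by
      apply Finset.sum_le_sum
      intro l _
      have := hdeg1 l
      split_ifs <;> omega
    rw [Finset.sum_add_distrib, ← Finset.card_filter] at h1
    simpa [mul_comm] using h1
  have hN2' : 2 * (Fintype.card Λ : ℝ) ≤ ∑ l, (deg l : ℝ) + S.card := by exact_mod_cast hN2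
  have ht : 2 * (S.card : ℝ) ≤ ∑ l, (tdeg l : ℝ) := by exact_mod_cast htsum
  rw [hsum]
  nlinarith

end IsPrivateCover

/-! ### From a DNF to a private cover. -/

/-- The rows of `M` at which the literal `l` is false. -/
def falseRows {k n : ℕ} (M : Matrix (Fin k) (Fin n) Bool) (l : Lit n) : Finset (Fin k) :=
  Finset.univ.filter fun i => M i l.1 ≠ l.2

theorem mem_falseRows {k n : ℕ} {M : Matrix (Fin k) (Fin n) Bool} {l : Lit n} {i : Fin k} :
    i ∈ falseRows M l ↔ M i l.1 ≠ l.2 := by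
  simp [falseRows]

theorem weight_le_card_falseRows {k n : ℕ} (M : Matrix (Fin k) (Fin n) Bool) (l : Lit n) :
    (weight fun i => M i l.1) ≤ (falseRows M l).card := by
  obtain ⟨j, σ⟩ := l
  unfold weight falseRows
  cases σ
  · simp
  · simp

theorem isPrivateCover_falseRows {k n : ℕ} {M : Matrix (Fin k) (Fin n) Bool} {h : BoolFn n}
    (hM : IsZeroMatrix M h) (hred : HasReducedColumns M)
    (hrows : ∀ i i' j, (∀ j', j' ≠ j → M i j' = M i' j') → i = i')
    {D : DNF n} (hD : DNF.Realizes D h) : IsPrivateCover (falseRows M) D where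
  cover := by
    intro K hK i
    have h0 : h (M i) = false := (hM.2 _).2 ⟨i, rfl⟩
    by_contra! hcon
    have : h (M i) = true := (hD.2 _).2 ⟨K, hK, fun l hl => by
      simpa [mem_falseRows] using hcon l hl⟩
    simp [h0] at this
  alone := by
    rintro ⟨j, σ⟩ i hi
    rw [mem_falseRows] at hi
    simp only at hi
    -- The update changes the entry, since `M i j ≠ σ`; a zero there would agree with row `i`
    -- outside column `j`.
    have h1 : h (Function.update (M i) j σ) = true := by
      by_contra hne
      obtain ⟨i', hi'⟩ := (hM.2 _).1 (Bool.eq_false_iff.2 hne)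
      have : i = i' := hrows i i' j fun j' hj' => by rw [hi', Function.update_of_ne hj']
      subst this
      apply hi
      conv_lhs => rw [hi']
      simp
    obtain ⟨K, hK, hx⟩ := (hD.2 _).1 h1
    -- `K` holds at the changed point, so `(j, σ)` is the only literal of `K` that can be false at
    -- row `i`.
    have hkey : ∀ l ∈ K, M i l.1 ≠ l.2 → l = (j, σ) := by
      intro l hl hne
      have hxl := hx l hl
      by_cases hj : l.1 = j
      · rw [hj, Function.update_self] at hxl
        exact Prod.ext hj hxl.symm
      · rw [Function.update_of_ne hj] at hxl
        exact absurd hxl hne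
    refine ⟨K, hK, ?_, fun l' hl' hne => ?_⟩
    · by_contra hnot
      have h0 : h (M i) = false := (hM.2 _).2 ⟨i, rfl⟩
      have : h (M i) = true := (hD.2 _).2 ⟨K, hK, fun l hl => by
        by_contra hne
        exact hnot (hkey l hl hne ▸ hl)⟩
      simp [h0] at this
    · rw [mem_falseRows]
      exact fun h => hne (hkey l' hl' h)
  ne_compl := by
    rintro K hK ⟨j, σ⟩ hl ⟨j', σ'⟩ hl' he
    have hmem : ∀ i, M i j' ≠ σ' ↔ M i j = σ := by
      intro i
      have := congrArg (i ∈ ·) he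
      simpa [mem_falseRows] using this
    by_cases hj : j = j'
    · subst hj
      by_cases hσ : σ = σ'
      · subst hσ
        obtain ⟨i, -⟩ := hred.exists_one j
        have := hmem i
        tauto
      · apply hD.1 K hK j
        cases σ <;> cases σ' <;> simp_all
    · by_cases hσ : σ = σ'
      · subst hσ
        obtain ⟨i, hi⟩ := hred.not_negation j j'
        have := hmem i
        revert this hi
        cases M i j <;> cases M i j' <;> cases σ <;> simp
      · obtain ⟨i, hi⟩ := hred.distinct j j' hj
        have := hmem i
        revert this hi hσ
        cases M i j <;> cases M i j' <;> cases σ <;> cases σ' <;> simp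
  nonempty := by
    rintro ⟨j, σ⟩
    cases σ
    · obtain ⟨i, hi⟩ := hred.exists_one j
      exact ⟨i, by simp [mem_falseRows, hi]⟩
    · obtain ⟨i, hi⟩ := hred.exists_zero j
      exact ⟨i, by simp [mem_falseRows, hi]⟩
  ne_univ := by
    rintro ⟨j, σ⟩ he
    have hall : ∀ i, M i j ≠ σ := fun i => by
      have : i ∈ falseRows M (j, σ) := he ▸ Finset.mem_univ i
      simpa [mem_falseRows] using this
    cases σ
    · obtain ⟨i, hi⟩ := hred.exists_zero j
      exact hall i hi
    · obtain ⟨i, hi⟩ := hred.exists_one j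
      exact hall i hi

theorem exists_realizes_rank_eq_minRank {n : ℕ} (f : BoolFn n) :
    ∃ D : DNF n, DNF.Realizes D f ∧ DNF.rank D = minRank f := by
  obtain ⟨D, hD⟩ := exists_dnf_realizes f
  exact Nat.sInf_mem (s := {r : ℕ | ∃ D : DNF n, DNF.Realizes D f ∧ DNF.rank D = r})
    ⟨_, D, hD, rfl⟩

theorem minRank_le {n : ℕ} {f : BoolFn n} {D : DNF n} (hD : DNF.Realizes D f) :
    minRank f ≤ DNF.rank D :=
  Nat.sInf_le ⟨D, hD, rfl⟩

/-- The private-cover bound for the `2 * n` literals with `lo = k / 2 - s` and `d = 2 * s`; then `d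
< lo` is `6 * s < k`. -/
theorem le_minRank_of_weight_ge {k n : ℕ} {M : Matrix (Fin k) (Fin n) Bool} {h : BoolFn n}
    (hM : IsZeroMatrix M h) (hred : HasReducedColumns M)
    (hrows : ∀ i i' j, (∀ j', j' ≠ j → M i j' = M i' j') → i = i') {s : ℝ} (hs : 0 ≤ s)
    (hsk : 6 * s < k) (hw : ∀ j, (k : ℝ) / 2 - s ≤ (weight fun i => M i j : ℕ)) :
    (5 / 2 * k - 13 * s) * (2 * n) ≤ (3 / 2 * k - 7 * s) * minRank h := by
  obtain ⟨D, hD, hr⟩ := exists_realizes_rank_eq_minRank h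
  have := (isPrivateCover_falseRows hM hred hrows hD).le_sum_card (lo := (k : ℝ) / 2 - s)
    (d := 2 * s) (fun l => (hw l.1).trans (by exact_mod_cast weight_le_card_falseRows M l))
    (by rw [Fintype.card_fin]; ring) (by linarith) (by linarith)
  rw [← hr, DNF.rank]
  push_cast
  rw [Fintype.card_prod, Fintype.card_fin, Fintype.card_bool] at this
  push_cast at this
  linarith

/-! ### Substituting zeros for extra variables. -/

/-- Setting the last variables to zero does not increase the rank. -/
theorem minRank_le_of_extend {n m : ℕ} (hnm : n ≤ m) {f : BoolFn n} {g : BoolFn m}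
    (hfg : ∀ x : Fin n → Bool, g (fun j => if h : j.1 < n then x ⟨j.1, h⟩ else false) = f x) :
    minRank f ≤ minRank g := by
  classical
  obtain ⟨D, hD, hr⟩ := exists_realizes_rank_eq_minRank g
  set ext : (Fin n → Bool) → Fin m → Bool :=
    fun x j => if h : j.1 < n then x ⟨j.1, h⟩ else false with hext
  have hin : ∀ x j, ext x (Fin.castLE hnm j) = x j := fun x j => by simp [hext]
  have hout : ∀ x (j : Fin m), ¬ j.1 < n → ext x j = false := fun x j h => by simp [hext, h]
  -- Conjunctions falsified by the substitution are dropped; the others lose their literals in the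
  -- extra variables.
  set E : DNF n := (D.filter fun K => ∀ l ∈ K, ¬ l.1.1 < n → l.2 = false).image fun K =>
    Finset.univ.filter fun l : Lit n => (Fin.castLE hnm l.1, l.2) ∈ K with hE
  have hreal : DNF.Realizes E f := by
    constructor
    · intro K hK j hj
      obtain ⟨K', hK', rfl⟩ := Finset.mem_image.1 hK
      simp only [Finset.mem_filter, Finset.mem_univ, true_and] at hj
      exact hD.1 K' (Finset.mem_filter.1 hK').1 _ hj
    · intro x
      rw [← hfg x, hD.2]
      constructor
      · rintro ⟨K, hK, hx⟩
        refine ⟨_, Finset.mem_image_of_mem _ (Finset.mem_filter.2 ⟨hK, fun l hl hn => ?_⟩), ?_⟩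
        · rw [← hx l hl]
          exact hout x l.1 hn
        · intro l hl
          have := hx _ (Finset.mem_filter.1 hl).2
          rwa [← hin x l.1]
      · rintro ⟨K', hK', hx⟩
        obtain ⟨K, hK, rfl⟩ := Finset.mem_image.1 hK'
        rw [Finset.mem_filter] at hK
        refine ⟨K, hK.1, fun l hl => ?_⟩
        by_cases h : l.1.1 < n
        · have := hx (⟨l.1.1, h⟩, l.2) (Finset.mem_filter.2 ⟨Finset.mem_univ _, hl⟩)
          simpa [h] using this
        · rw [hK.2 l hl h]
          exact hout x l.1 h
  refine (minRank_le hreal).trans ?_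
  rw [← hr, DNF.rank, DNF.rank, hE]
  refine (Finset.sum_image_le_of_nonneg (g := fun K : Finset (Lit m) =>
    (Finset.univ.filter fun l : Lit n => (Fin.castLE hnm l.1, l.2) ∈ K))
    (f := fun K : Finset (Lit n) => K.card) (fun _ _ => Nat.zero_le _)).trans ?_
  refine (Finset.sum_le_sum (g := fun K : Finset (Lit m) => K.card) fun K _ => ?_).trans
    (Finset.sum_le_sum_of_subset (Finset.filter_subset _ _))
  refine Finset.card_le_card_of_injOn (fun l => (Fin.castLE hnm l.1, l.2))
    (fun l hl => (Finset.mem_filter.1 hl).2) ?_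
  rintro ⟨j, σ⟩ - ⟨j', σ'⟩ - he
  simpa using he

/-! ### Columns up to negation, and matrices built from them. -/

theorem two_mul_card_filter_eq_false {k : ℕ} (i : Fin k) (P : (Fin k → Bool) → Prop)
    [DecidablePred P] (hP : ∀ v, P v → P fun j => !v j) :
    2 * (Finset.univ.filter fun v : Fin k → Bool => v i = false ∧ P v).card =
      (Finset.univ.filter fun v : Fin k → Bool => P v).card := by
  have h1 : (Finset.univ.filter fun v : Fin k → Bool => v i = false ∧ P v).card =
      (Finset.univ.filter fun v : Fin k → Bool => ¬ v i = false ∧ P v).card := by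
    apply Finset.card_nbij (fun v j => !v j)
    · intro v hv
      simp only [Finset.coe_filter, Finset.mem_univ, true_and, Set.mem_ofPred_eq] at hv ⊢
      exact ⟨by simp [hv.1], hP v hv.2⟩
    · intro v _ w _ h
      funext j
      simpa using congrFun h j
    · intro v hv
      simp only [Finset.coe_filter, Finset.mem_univ, true_and, Set.mem_ofPred_eq] at hv
      refine ⟨fun j => !v j, ?_, by simp⟩
      simp only [Finset.coe_filter, Finset.mem_univ, true_and, Set.mem_ofPred_eq]
      exact ⟨by simpa using hv.1, hP v hv.2⟩
  have h2 := Finset.card_filter_add_card_filter_not (s := Finset.univ.filter fun v => P v)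
    (fun v : Fin k → Bool => v i = false)
  rw [Finset.filter_filter, Finset.filter_filter] at h2
  simp only [and_comm (a := P _)] at h2
  omega

theorem card_filter_eq_false {k : ℕ} (i : Fin k) :
    (Finset.univ.filter fun v : Fin k → Bool => v i = false).card = 2 ^ (k - 1) := by
  have h := two_mul_card_filter_eq_false i (fun _ => True) (fun _ _ => trivial)
  simp only [and_true, Finset.filter_true, Finset.card_univ, Fintype.card_fun, Fintype.card_bool,
    Fintype.card_fin] at h
  obtain ⟨m, rfl⟩ : ∃ m, k = m + 1 := ⟨k - 1, by have := i.2; omega⟩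
  rw [pow_succ] at h
  simp only [Nat.add_sub_cancel]
  omega

theorem two_mul_card_filter_eq_false_eq_false {k : ℕ} {i i' : Fin k} (hne : i ≠ i') :
    2 * (Finset.univ.filter fun v : Fin k → Bool => v i = false ∧ v i' = false).card ≤
      2 ^ (k - 1) := by
  have h1 : (Finset.univ.filter fun v : Fin k → Bool => v i = false ∧ v i' = false).card ≤
      (Finset.univ.filter fun v : Fin k → Bool => v i = false ∧ ¬ v i' = false).card := by
    apply Finset.card_le_card_of_injOn (fun v => Function.update v i' true)
    · intro v hv
      simp only [Finset.coe_filter, Finset.mem_univ, true_and, Set.mem_ofPred_eq] at hv ⊢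
      simp [Function.update_of_ne hne, hv.1]
    · intro v hv w hw h
      simp only [Finset.coe_filter, Finset.mem_univ, true_and, Set.mem_ofPred_eq] at hv hw
      funext j
      by_cases hj : j = i'
      · rw [hj, hv.2, hw.2]
      · simpa [Function.update_of_ne hj] using congrFun h j
  have h2 := Finset.card_filter_add_card_filter_not
    (s := Finset.univ.filter fun v : Fin k → Bool => v i = false)
    (fun v : Fin k → Bool => v i' = false)
  rw [Finset.filter_filter, Finset.filter_filter, card_filter_eq_false i] at h2
  omega

/-- The columns that vanish in row `i`, are not zero and satisfy `P`. -/
noncomputable def columnsOf {k : ℕ} (i : Fin k) (P : (Fin k → Bool) → Prop) :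
    Finset (Fin k → Bool) := by
  classical
  exact (Finset.univ.filter fun v => v i = false ∧ P v).erase fun _ => false

theorem mem_columnsOf {k : ℕ} {i : Fin k} {P : (Fin k → Bool) → Prop} {v : Fin k → Bool} :
    v ∈ columnsOf i P ↔ (∃ j, v j = true) ∧ v i = false ∧ P v := by
  classical
  rw [columnsOf, Finset.mem_erase, Finset.mem_filter]
  simp [funext_iff]

theorem card_columnsOf_true {k : ℕ} (i : Fin k) :
    (columnsOf i fun _ => True).card = 2 ^ (k - 1) - 1 := by
  classical
  rw [columnsOf, Finset.card_erase_of_mem (by simp)]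
  simp only [and_true]
  rw [← card_filter_eq_false i]

/-- The matrix whose columns are the members of a finite set. -/
def matrixOfColumns {k n : ℕ} {C : Finset (Fin k → Bool)} (e : C ≃ Fin n) :
    Matrix (Fin k) (Fin n) Bool :=
  fun i j => (e.symm j).1 i

theorem hasReducedColumns_matrixOfColumns {k n : ℕ} {i : Fin k} {P : (Fin k → Bool) → Prop}
    (e : columnsOf i P ≃ Fin n) : HasReducedColumns (matrixOfColumns e) where
  exists_one j := (mem_columnsOf.1 (e.symm j).2).1
  exists_zero j := ⟨i, (mem_columnsOf.1 (e.symm j).2).2.1⟩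
  distinct j j' hne := by
    by_contra! hcon
    exact hne (e.symm.injective (Subtype.ext (funext hcon)))
  not_negation j j' := by
    refine ⟨i, ?_⟩
    rw [matrixOfColumns, matrixOfColumns, (mem_columnsOf.1 (e.symm j).2).2.1,
      (mem_columnsOf.1 (e.symm j').2).2.1]
    simp

theorem rows_matrixOfColumns {k n : ℕ} {i₀ : Fin k} {P : (Fin k → Bool) → Prop}
    (e : columnsOf i₀ P ≃ Fin n) (hP : ∀ v, P v → P fun j => !v j)
    (hsep : ∀ i i', i ≠ i' → ∃ v, P v ∧ v i ≠ v i') :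
    Function.Injective fun i => matrixOfColumns e i := by
  intro i i' h
  by_contra hne
  obtain ⟨v, hv, hvi⟩ := hsep i i' hne
  -- A separating vector or its negation vanishes at `i₀`, and both separate the two rows.
  have key : ∀ w : Fin k → Bool, P w → w i ≠ w i' → w i₀ = false → False := by
    intro w hw hwi h0
    have hmem : w ∈ columnsOf i₀ P := by
      refine mem_columnsOf.2 ⟨?_, h0, hw⟩
      by_contra! hcon
      apply hwi
      rw [Bool.eq_false_iff.2 (hcon i), Bool.eq_false_iff.2 (hcon i')]
    have := congrFun h (e ⟨w, hmem⟩)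
    simp only [matrixOfColumns, Equiv.symm_apply_apply] at this
    exact hwi this
  cases h0 : v i₀
  · exact key v hv hvi h0
  · exact key _ (hP v hv) (by simpa using hvi) (by simp [h0])

/-- The function whose zeros are the rows of `M`. -/
noncomputable def zeroFn {k n : ℕ} (M : Matrix (Fin k) (Fin n) Bool) : BoolFn n := by
  classical
  exact fun x => !decide (∃ i, M i = x)

theorem isZeroMatrix_zeroFn {k n : ℕ} {M : Matrix (Fin k) (Fin n) Bool}
    (hM : Function.Injective fun i => M i) : IsZeroMatrix M (zeroFn M) :=
  ⟨hM, fun x => by simp [zeroFn]⟩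

theorem IsZeroMatrix.mem_zeroClass {k n : ℕ} {M : Matrix (Fin k) (Fin n) Bool} {f : BoolFn n}
    (hM : IsZeroMatrix M f) : f ∈ zeroClass k n := by
  have : (Finset.univ.filter fun x => f x = false) = Finset.univ.image fun i => M i := by
    ext x
    rw [Finset.mem_filter, hM.2, Finset.mem_image]
    simp
  rw [zeroClass, Set.mem_ofPred_eq, this, Finset.card_image_of_injective _ hM.1,
    Finset.card_univ, Fintype.card_fin]

theorem exists_isCompleteFn {k : ℕ} (hk : 1 ≤ k) :
    ∃ φ : BoolFn (2 ^ (k - 1) - 1), IsCompleteFn k φ := by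
  have e := Finset.equivFinOfCardEq (card_columnsOf_true (⟨0, hk⟩ : Fin k))
  have hrows := rows_matrixOfColumns e (fun _ _ => trivial) (fun i i' hne =>
    ⟨fun j => decide (j = i), trivial, by simp [hne.symm]⟩)
  exact ⟨_, _, isZeroMatrix_zeroFn hrows, hasReducedColumns_matrixOfColumns e⟩

/-- Adding the entry in row `i₀` replaces each column by the member of its negation pair that
vanishes at `i₀`; reduced columns lie in distinct pairs. -/
theorem HasReducedColumns.injective_xor {k n : ℕ} {M : Matrix (Fin k) (Fin n) Bool}
    (h : HasReducedColumns M) (i₀ : Fin k) :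
    Function.Injective fun (j : Fin n) (i : Fin k) => xor (M i j) (M i₀ j) := by
  intro j j' he
  by_contra hne
  by_cases h0 : M i₀ j = M i₀ j'
  · obtain ⟨i, hi⟩ := h.distinct j j' hne
    have := congrFun he i
    simp only [h0, Bool.xor_left_inj] at this
    exact hi this
  · obtain ⟨i, hi⟩ := h.not_negation j j'
    have : xor (M i j) (M i₀ j) = xor (M i j') (M i₀ j') := congrFun he i
    revert this hi h0
    cases M i j <;> cases M i j' <;> cases M i₀ j <;> cases M i₀ j' <;> simp

theorem HasReducedColumns.le {k n : ℕ} {M : Matrix (Fin k) (Fin n) Bool}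
    (h : HasReducedColumns M) (hk : 1 ≤ k) : n ≤ 2 ^ (k - 1) - 1 := by
  rw [← card_columnsOf_true (⟨0, hk⟩ : Fin k), ← Fintype.card_fin n, ← Finset.card_univ]
  refine Finset.card_le_card_of_injOn _ (fun j _ => ?_) (h.injective_xor ⟨0, hk⟩).injOn
  refine mem_columnsOf.2 ⟨?_, by simp, trivial⟩
  cases h0 : M ⟨0, hk⟩ j
  · obtain ⟨i, hi⟩ := h.exists_one j
    exact ⟨i, by simp [hi]⟩
  · obtain ⟨i, hi⟩ := h.exists_zero j
    exact ⟨i, by simp [hi]⟩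

/-- Two rows that differ in at most one column limit the number of columns. -/
theorem HasReducedColumns.le_of_agree {k n : ℕ} {M : Matrix (Fin k) (Fin n) Bool}
    (h : HasReducedColumns M) {i i' : Fin k} (hne : i ≠ i') {j : Fin n}
    (hj : ∀ j', j' ≠ j → M i j' = M i' j') : 2 * n ≤ 2 ^ (k - 1) + 2 := by
  -- Normalised to vanish at row `i`, every column other than `j` vanishes at row `i'` too, which
  -- leaves at most a quarter of all vectors.
  have h1 : (Finset.univ.erase j).card ≤
      (Finset.univ.filter fun v : Fin k → Bool => v i = false ∧ v i' = false).card := by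
    refine Finset.card_le_card_of_injOn _ (fun j' hj' => ?_) (h.injective_xor i).injOn
    have := hj j' (Finset.ne_of_mem_erase hj')
    simp [this]
  rw [Finset.card_erase_of_mem (Finset.mem_univ _), Finset.card_univ, Fintype.card_fin] at h1
  have := two_mul_card_filter_eq_false_eq_false hne
  omega

theorem weight_not {k : ℕ} (v : Fin k → Bool) : (weight fun i => !v i) = weight v := by
  simp [weight, min_comm]

theorem card_true_add_card_false {k : ℕ} (v : Fin k → Bool) :
    (Finset.univ.filter fun i => v i = true).card +
      (Finset.univ.filter fun i => v i = false).card = k := by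
  have := Finset.card_filter_add_card_filter_not (s := (Finset.univ : Finset (Fin k)))
    (fun i => v i = true)
  simpa using this

/-! ### Almost all columns are balanced. -/

/-- Chernoff's bound for the number of Boolean vectors with many more zeros than ones. -/
theorem card_filter_mul_exp_le {k : ℕ} {t a : ℝ} (ht : 0 ≤ t) :
    ((Finset.univ.filter fun v : Fin k → Bool =>
      a ≤ (Finset.univ.filter fun i => v i = false).card -
        ((Finset.univ.filter fun i => v i = true).card : ℝ)).card : ℝ) * Real.exp (t * a) ≤
      2 ^ k * Real.exp (k * (t ^ 2 / 2)) := by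
  have hprod : ∀ v : Fin k → Bool, ∏ i, Real.exp (if v i = true then -t else t) =
      Real.exp (t * ((Finset.univ.filter fun i => v i = false).card -
        ((Finset.univ.filter fun i => v i = true).card : ℝ))) := by
    intro v
    rw [← Real.exp_sum, Finset.sum_ite, Finset.sum_const, Finset.sum_const]
    simp only [Bool.not_eq_true, nsmul_eq_mul]
    ring_nf
  -- The generating sum factorises over the coordinates; the bound then follows from `cosh t ≤ exp
  -- (t ^ 2 / 2)`.
  have hsum : (2 * Real.cosh t) ^ k =
      ∑ v : Fin k → Bool, Real.exp (t * ((Finset.univ.filter fun i => v i = false).card -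
        ((Finset.univ.filter fun i => v i = true).card : ℝ))) := by
    have h1 := Fintype.sum_pow (fun b : Bool => Real.exp (if b = true then -t else t)) k
    simp only [hprod] at h1
    rw [← h1, Real.cosh_eq]
    congr 1
    simp
    ring
  have h2 : (2 * Real.cosh t) ^ k ≤ 2 ^ k * Real.exp (k * (t ^ 2 / 2)) := by
    rw [mul_pow, Real.exp_nat_mul]
    gcongr
    exact Real.cosh_le_exp_half_sq t
  refine le_trans ?_ h2
  rw [hsum, ← nsmul_eq_mul]
  refine (Finset.card_nsmul_le_sum _ _ _ fun v hv => ?_).trans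
    (Finset.sum_le_sum_of_subset_of_nonneg (Finset.filter_subset _ _)
      fun _ _ _ => (Real.exp_pos _).le)
  have := (Finset.mem_filter.1 hv).2
  gcongr

theorem card_filter_weight_lt_mul_sq_le {k : ℕ} (hk : 1 ≤ k) :
    ((Finset.univ.filter fun v : Fin k → Bool =>
      ((weight v : ℕ) : ℝ) < (k : ℝ) / 2 - √((k : ℝ) * Real.log k)).card : ℝ) * (k : ℝ) ^ 2 ≤
      2 * 2 ^ k := by
  classical
  have hk0 : (0 : ℝ) < k := by exact_mod_cast hk
  have hL : 0 ≤ Real.log k := Real.log_natCast_nonneg k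
  set s := √((k : ℝ) * Real.log k) with hs
  have hs0 : 0 ≤ s := Real.sqrt_nonneg _
  have hss : s ^ 2 = k * Real.log k := Real.sq_sqrt (by positivity)
  set U := Finset.univ.filter fun v : Fin k → Bool =>
      2 * s ≤ (Finset.univ.filter fun i => v i = false).card -
        ((Finset.univ.filter fun i => v i = true).card : ℝ) with hU
  have hUcard : (U.card : ℝ) * (k : ℝ) ^ 2 ≤ 2 ^ k := by
    -- The optimal parameter is `t = a / k`: the left exponent is `4 * log k`, the right one `2 *
    -- log k`, which leaves the factor `k ^ 2`.
    have h1 := card_filter_mul_exp_le (k := k) (t := 2 * s / k) (a := 2 * s) (by positivity)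
    have e1 : 2 * s / k * (2 * s) = 2 * Real.log k + 2 * Real.log k := by
      field_simp
      linarith
    have e2 : (k : ℝ) * ((2 * s / k) ^ 2 / 2) = 2 * Real.log k := by
      field_simp
      linarith
    rw [e1, e2, Real.exp_add, ← mul_assoc] at h1
    have h2 := le_of_mul_le_mul_right h1 (Real.exp_pos _)
    have e3 : Real.exp (2 * Real.log k) = (k : ℝ) ^ 2 := by
      rw [two_mul, Real.exp_add, Real.exp_log hk0, sq]
    rwa [e3] at h2
  -- Too few ones puts `v` itself in the tail `U`, too few zeros puts its negation there.
  have hsub : (Finset.univ.filter fun v : Fin k → Bool =>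
      ((weight v : ℕ) : ℝ) < (k : ℝ) / 2 - s) ⊆ U ∪ U.image fun v i => !v i := by
    intro v hv
    have hw := (Finset.mem_filter.1 hv).2
    have hc : ((Finset.univ.filter fun i => v i = true).card : ℝ) +
      (Finset.univ.filter fun i => v i = false).card = k := by
      exact_mod_cast card_true_add_card_false v
    rw [weight, Nat.cast_min, min_lt_iff] at hw
    rw [Finset.mem_union, Finset.mem_image]
    rcases hw with hw | hw
    · left
      rw [hU, Finset.mem_filter]
      exact ⟨Finset.mem_univ _, by linarith⟩
    · right
      refine ⟨fun i => !v i, ?_, by simp⟩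
      rw [hU, Finset.mem_filter]
      refine ⟨Finset.mem_univ _, ?_⟩
      simp only [Bool.not_eq_true', Bool.not_eq_false']
      linarith
  have h3 : (Finset.univ.filter fun v : Fin k → Bool =>
      ((weight v : ℕ) : ℝ) < (k : ℝ) / 2 - s).card ≤ U.card + U.card :=
    (Finset.card_le_card hsub).trans ((Finset.card_union_le _ _).trans
      (Nat.add_le_add_left Finset.card_image_le _))
  have h4 : ((Finset.univ.filter fun v : Fin k → Bool =>
      ((weight v : ℕ) : ℝ) < (k : ℝ) / 2 - s).card : ℝ) ≤ U.card + U.card := by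
    exact_mod_cast h3
  have : (0 : ℝ) ≤ (k : ℝ) ^ 2 := by positivity
  nlinarith

/-- The balanced columns, one from each pair of a column and its negation. -/
noncomputable def balancedColumns {k : ℕ} (i : Fin k) : Finset (Fin k → Bool) :=
  columnsOf i fun v => (k : ℝ) / 2 - √((k : ℝ) * Real.log k) ≤ (weight v : ℕ)

theorem le_card_balancedColumns {k : ℕ} (i : Fin k) :
    (2 : ℝ) ^ (k - 1) * (1 - 2 / (k : ℝ)) ≤ (balancedColumns i).card := by
  classical
  have hk : 1 ≤ k := by have := i.2; omega
  have hk0 : (0 : ℝ) < k := by exact_mod_cast hk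
  rcases hk.eq_or_lt with rfl | hk2
  · refine le_trans ?_ (Nat.cast_nonneg _)
    norm_num
  have hk2' : (2 : ℝ) ≤ k := by exact_mod_cast hk2
  set P : (Fin k → Bool) → Prop :=
    fun v => (k : ℝ) / 2 - √((k : ℝ) * Real.log k) ≤ (weight v : ℕ) with hP
  have h1 := two_mul_card_filter_eq_false i P (fun v hv => by
    simpa only [hP, weight_not] using hv)
  have h2 : (Finset.univ.filter fun v : Fin k → Bool => v i = false ∧ P v).card ≤
      (balancedColumns i).card + 1 := by
    rw [balancedColumns, columnsOf]
    have := Finset.pred_card_le_card_erase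
      (s := Finset.univ.filter fun v : Fin k → Bool => v i = false ∧ P v)
      (a := fun _ => false)
    have h3 : (Finset.univ.filter fun v : Fin k → Bool => v i = false ∧ P v).card - 1 + 1 ≤
      ((Finset.univ.filter fun v : Fin k → Bool => v i = false ∧ P v).erase
        fun _ => false).card + 1 := Nat.add_le_add_right this 1
    refine le_trans (by omega) (h3.trans (le_of_eq ?_))
    congr!
  have h3 : (Finset.univ.filter fun v : Fin k → Bool => P v).card +
      (Finset.univ.filter fun v : Fin k → Bool => ¬ P v).card = 2 ^ k := by
    rw [Finset.card_filter_add_card_filter_not, Finset.card_univ, Fintype.card_fun,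
      Fintype.card_bool, Fintype.card_fin]
  have h4 : ((Finset.univ.filter fun v : Fin k → Bool => ¬ P v).card : ℝ) * (k : ℝ) ^ 2 ≤
      2 * 2 ^ k := by
    simpa only [hP, not_le] using card_filter_weight_lt_mul_sq_le hk
  set X : ℝ := (2 : ℝ) ^ (k - 1) with hX
  have hX2 : (2 : ℝ) ^ k = 2 * X := by
    rw [hX, ← pow_succ']
    congr 1
    omega
  have hXk : (k : ℝ) ≤ X := by
    have : k - 1 < 2 ^ (k - 1) := Nat.lt_two_pow_self
    have : k ≤ 2 ^ (k - 1) := by omega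
    rw [hX]
    exact_mod_cast this
  have h5 : (2 : ℝ) ^ k ≤ 2 * ((balancedColumns i).card + 1) +
      (Finset.univ.filter fun v : Fin k → Bool => ¬ P v).card := by
    have : 2 ^ k ≤ 2 * ((balancedColumns i).card + 1) +
      (Finset.univ.filter fun v : Fin k → Bool => ¬ P v).card := by omega
    exact_mod_cast this
  rw [hX2] at h4 h5
  have h6 : ((Finset.univ.filter fun v : Fin k → Bool => ¬ P v).card : ℝ) ≤
      4 * X / (k : ℝ) ^ 2 := by
    rw [le_div_iff₀ (by positivity)]
    linarith
  -- The loss `2 * X / k` splits into the share of unbalanced columns and a rest that, by `k ≤ X`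
  -- and `2 ≤ k`, pays for the discarded zero column.
  have h7 : X * (1 - 2 / (k : ℝ)) = X - 2 * X / (k : ℝ) ^ 2 - 2 * X * (k - 1) / (k : ℝ) ^ 2 := by
    field_simp
    ring
  have h8 : 1 ≤ 2 * X * (k - 1) / (k : ℝ) ^ 2 := by
    rw [le_div_iff₀ (by positivity)]
    nlinarith
  have h9 : 4 * X / (k : ℝ) ^ 2 = 2 * (2 * X / (k : ℝ) ^ 2) := by ring
  rw [h7]
  linarith

theorem half_le_sqrt_mul_log {k : ℕ} (hk : 2 ≤ k) : 1 / 2 ≤ √((k : ℝ) * Real.log k) := by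
  apply Real.le_sqrt_of_sq_le
  have hk2 : (2 : ℝ) ≤ k := by exact_mod_cast hk
  have h1 : Real.log 2 ≤ Real.log k := Real.log_le_log (by norm_num) hk2
  have := Real.log_two_gt_d9
  nlinarith

theorem exists_isBalanced {k : ℕ} (i₀ : Fin k) :
    ∃ H : Matrix (Fin k) (Fin (balancedColumns i₀).card) Bool, IsBalanced H := by
  have hk : 1 ≤ k := by have := i₀.2; omega
  refine ⟨matrixOfColumns (balancedColumns i₀).equivFin, ?_,
    hasReducedColumns_matrixOfColumns _, fun j => ?_⟩
  · apply rows_matrixOfColumns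
    · intro v hv
      simpa only [weight_not] using hv
    · intro i i' hne
      have hk2 : 2 ≤ k := by
        have h1 := i.2
        have h2 := i'.2
        have h3 : i.1 ≠ i'.1 := fun h => hne (Fin.ext h)
        omega
      -- A set of size `k / 2` containing `i` but not `i'` gives a separating vector. Its weight
      -- falls short of half of `k` by at most 1/2, which the balance condition allows for `2 ≤ k`.
      obtain ⟨S, hiS, hSi, hS⟩ := Finset.exists_subsuperset_card_eq (s := {i}) (t := {i'}ᶜ)
        (n := k / 2) (by simpa using hne.symm) (by rw [Finset.card_singleton]; omega)
        (by rw [Finset.card_compl, Finset.card_singleton, Fintype.card_fin]; omega)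
      have h1 : i ∈ S := hiS (by simp)
      have h2 : i' ∉ S := fun h => by simpa using hSi h
      refine ⟨fun j => decide (j ∈ S), ?_, by simp [h1, h2]⟩
      have hw : k / 2 ≤ weight fun j => decide (j ∈ S) := by
        have hc := card_true_add_card_false fun j => decide (j ∈ S)
        have : (Finset.univ.filter fun j => decide (j ∈ S) = true).card = k / 2 := by
          rw [← hS]
          congr 1
          ext
          simp
        rw [weight]
        omega
      have hw' : ((k / 2 : ℕ) : ℝ) ≤ ((weight fun j => decide (j ∈ S) : ℕ) : ℝ) := by
        exact_mod_cast hw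
      have h3 : (k : ℝ) ≤ 2 * ((k / 2 : ℕ) : ℝ) + 1 := by
        have : k ≤ 2 * (k / 2) + 1 := by omega
        exact_mod_cast this
      have := half_le_sqrt_mul_log hk2
      linarith
  · exact (mem_columnsOf.1 ((balancedColumns i₀).equivFin.symm j).2).2.2

theorem exists_isExtremal {k : ℕ} (hk : 1 ≤ k) : ∃ (n : ℕ) (h : BoolFn n), IsExtremal k h := by
  set S : Set ℕ := {n | ∃ H : Matrix (Fin k) (Fin n) Bool, IsBalanced H} with hS
  have hne : S.Nonempty := ⟨_, exists_isBalanced ⟨0, hk⟩⟩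
  have hbdd : BddAbove S := ⟨2 ^ (k - 1) - 1, fun n ⟨_, hH⟩ => hH.columns.le hk⟩
  obtain ⟨H, hH⟩ := Nat.sSup_mem hne hbdd
  exact ⟨sSup S, zeroFn H, H, isZeroMatrix_zeroFn hH.rows, hH,
    fun n' H' hH' => le_csSup hbdd ⟨H', hH'⟩⟩

theorem IsExtremal.le_card {k n : ℕ} {h : BoolFn n} (hk : 1 ≤ k) (hh : IsExtremal k h) :
    (2 : ℝ) ^ (k - 1) * (1 - 2 / (k : ℝ)) ≤ n := by
  obtain ⟨H, -, -, hmax⟩ := hh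
  obtain ⟨H', hH'⟩ := exists_isBalanced (⟨0, hk⟩ : Fin k)
  exact (le_card_balancedColumns _).trans (by exact_mod_cast hmax _ H' hH')

/-- Constant zero columns keep the rows distinct, and substituting zeros for the new variables
recovers `h`. -/
theorem IsExtremal.exists_mem_zeroClass {k n : ℕ} {h : BoolFn n} (hk : 1 ≤ k)
    (hh : IsExtremal k h) : ∃ g ∈ zeroClass k (2 ^ (k - 1) - 1), minRank h ≤ minRank g := by
  obtain ⟨H, hH, hb, -⟩ := hh
  have hn := hb.columns.le hk
  set ext : (Fin n → Bool) → Fin (2 ^ (k - 1) - 1) → Bool :=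
    fun x j => if h : j.1 < n then x ⟨j.1, h⟩ else false with hext
  have hinj : Function.Injective ext := by
    intro x y hxy
    funext j
    simpa [hext] using congrFun hxy (Fin.castLE hn j)
  set G : Matrix (Fin k) (Fin (2 ^ (k - 1) - 1)) Bool := fun i => ext (H i) with hG
  have hGr : Function.Injective fun i => G i := fun i i' he => hb.rows (hinj he)
  refine ⟨zeroFn G, (isZeroMatrix_zeroFn hGr).mem_zeroClass, minRank_le_of_extend hn fun x => ?_⟩
  have h1 : zeroFn G (ext x) = false ↔ h x = false := by
    rw [(isZeroMatrix_zeroFn hGr).2, hH.2]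
    exact exists_congr fun i => ⟨fun he => hinj he, fun he => congrArg ext he⟩
  change zeroFn G (ext x) = h x
  cases h2 : h x
  · exact h1.2 h2
  · exact Bool.eq_true_of_not_eq_false fun h3 => by simp [h1.1 h3] at h2

/-! ### Explicit and asymptotic lower bounds. -/

theorem mul_le_log_of_two_pow_le {m k : ℕ} (h : 2 ^ m ≤ k) : (m : ℝ) * 0.69 ≤ Real.log k := by
  have h1 : ((2 : ℝ) ^ m) ≤ k := by exact_mod_cast h
  have h2 := Real.log_le_log (by positivity) h1
  rw [Real.log_pow] at h2
  have := Real.log_two_gt_d9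
  have hm : (0 : ℝ) ≤ m := Nat.cast_nonneg m
  nlinarith

/-- The hypothesis on `k` of the lower bound leaves `k = 1` and large values only. -/
theorem large_of_sqrt_le {k : ℕ} (hk : 2 ≤ k)
    (h : 2 * √((k : ℝ) * Real.log k) / (k : ℝ) ≤ 1 / 4) :
    8 * √(Real.log k) ≤ √(k : ℝ) ∧ 128 ≤ k ∧ 4.8 ≤ Real.log k := by
  have hk0 : (0 : ℝ) < k := by exact_mod_cast (by omega : 0 < k)
  have hq : 0 < √(k : ℝ) := Real.sqrt_pos.2 hk0
  have hqq : √(k : ℝ) * √(k : ℝ) = k := Real.mul_self_sqrt hk0.le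
  have hL : 0 ≤ Real.log k := Real.log_natCast_nonneg k
  have hrr : √(Real.log k) * √(Real.log k) = Real.log k := Real.mul_self_sqrt hL
  have hr : 0 ≤ √(Real.log k) := Real.sqrt_nonneg _
  rw [div_le_iff₀ hk0, Real.sqrt_mul hk0.le] at h
  have h8 : 8 * √(Real.log k) ≤ √(k : ℝ) := by nlinarith
  have h64 : 64 * Real.log k ≤ k := by nlinarith
  -- Bootstrapping with `64 * log k ≤ k`: from `2 ≤ k` to `32 ≤ k`, then to `128 ≤ k`, and finally
  -- to `4.8 ≤ log k`.
  have l1 := mul_le_log_of_two_pow_le (m := 1) (k := k) (by omega)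
  push_cast at l1
  have k1 : 32 ≤ k := by
    have : (32 : ℝ) ≤ k := by linarith
    exact_mod_cast this
  have l2 := mul_le_log_of_two_pow_le (m := 5) (k := k) (by omega)
  push_cast at l2
  have k2 : 128 ≤ k := by
    have : (128 : ℝ) ≤ k := by linarith
    exact_mod_cast this
  have l3 := mul_le_log_of_two_pow_le (m := 7) (k := k) (by omega)
  push_cast at l3
  exact ⟨h8, k2, by linarith⟩

/-- Rows that differ in at most one column would halve the number of columns, against the assumed
size of `n`. -/
theorem HasReducedColumns.eq_of_agree {k n : ℕ} {M : Matrix (Fin k) (Fin n) Bool}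
    (hred : HasReducedColumns M) (hk : 128 ≤ k)
    (hn : (2 : ℝ) ^ (k - 1) * (1 - 2 / (k : ℝ)) ≤ n) (i i' : Fin k) (j : Fin n)
    (hj : ∀ j', j' ≠ j → M i j' = M i' j') : i = i' := by
  by_contra hne
  have h1 := hred.le_of_agree hne hj
  have h2 : 2 * (n : ℝ) ≤ 2 ^ (k - 1) + 2 := by exact_mod_cast h1
  have h3 : (128 : ℝ) ≤ (2 : ℝ) ^ (k - 1) := by
    calc (128 : ℝ) = 2 ^ 7 := by norm_num
      _ ≤ 2 ^ (k - 1) := pow_le_pow_right₀ (by norm_num) (by omega)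
  have hk0 : (128 : ℝ) ≤ k := by exact_mod_cast hk
  have h4 : 2 / (k : ℝ) ≤ 1 / 64 := by
    rw [div_le_div_iff₀ (by linarith) (by norm_num)]
    linarith
  nlinarith

/-- Here `q` stands for `√k` and `r` for `√(log k)`. After clearing denominators the two sides
differ by `q * r` times the quantity in `h1`, which is positive because `8 * r ≤ q` and `2 ≤ r`. -/
theorem lt_of_quadratic {q r : ℝ} (hq : 0 < q) (hr : 2 ≤ r) (hqr : 8 * r ≤ q) :
    (10 / 3 - 5 / 3 * (2 * r ^ 2 / (q + 2 * r ^ 2))) * (3 / 2 * q ^ 2 - 7 * (q * r)) <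
      5 * q ^ 2 - 26 * (q * r) := by
  have hd : 0 < q + 2 * r ^ 2 := by positivity
  have e : 10 / 3 - 5 / 3 * (2 * r ^ 2 / (q + 2 * r ^ 2)) =
      10 / 3 * (q + r ^ 2) / (q + 2 * r ^ 2) := by
    field_simp
    ring
  rw [e, div_mul_eq_mul_div, div_lt_iff₀ hd]
  have h1 : 0 < 5 * (q * r) - 8 / 3 * q - 86 / 3 * r ^ 2 := by nlinarith
  have h2 : 0 < q * r * (5 * (q * r) - 8 / 3 * q - 86 / 3 * r ^ 2) := by positivity
  nlinarith

theorem IsExtremal.lt_minRank {k n : ℕ} {h : BoolFn n} (hk : 1 ≤ k)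
    (hkc : 2 * √((k : ℝ) * Real.log k) / (k : ℝ) ≤ 1 / 4) (hh : IsExtremal k h) :
    (2 : ℝ) ^ (k - 1) *
          (10 / 3 - 5 / 3 * (2 * Real.log k / (√(k : ℝ) + 2 * Real.log k))) *
          (1 - 2 / (k : ℝ)) < minRank h := by
  rcases hk.eq_or_lt with rfl | hk2
  · refine lt_of_lt_of_le ?_ (Nat.cast_nonneg _)
    norm_num
  obtain ⟨h8, h128, hL⟩ := large_of_sqrt_le hk2 hkc
  have hk0 : (0 : ℝ) < k := by exact_mod_cast hk
  have hn := hh.le_card hk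
  obtain ⟨H, hH, hb, -⟩ := hh
  set q := √(k : ℝ) with hq
  set r := √(Real.log k) with hr
  have hq0 : 0 < q := Real.sqrt_pos.2 hk0
  have hqq : q ^ 2 = k := Real.sq_sqrt hk0.le
  have hrr : r ^ 2 = Real.log k := Real.sq_sqrt (by linarith)
  have hr0 : 2 ≤ r := Real.le_sqrt_of_sq_le (by linarith)
  have hs : √((k : ℝ) * Real.log k) = q * r := Real.sqrt_mul hk0.le _
  have hw := hb.weight_ge
  rw [hs] at hw
  have hmain := le_minRank_of_weight_ge hH hb.columns
    (hb.columns.eq_of_agree h128 hn) (by positivity : 0 ≤ q * r) (by nlinarith) hw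
  have hpos : 0 < 3 / 2 * k - 7 * (q * r) := by nlinarith
  have hlt := lt_of_quadratic hq0 hr0 h8
  rw [hqq, hrr] at hlt
  set F := 10 / 3 - 5 / 3 * (2 * Real.log k / (q + 2 * Real.log k)) with hF
  have hF0 : 0 ≤ F := by
    have : 2 * Real.log k / (q + 2 * Real.log k) ≤ 1 := by
      rw [div_le_one (by linarith)]
      linarith
    linarith
  have hn0 : (0 : ℝ) < n := by
    refine lt_of_lt_of_le (mul_pos (by positivity) ?_) hn
    have hk128 : (128 : ℝ) ≤ k := by exact_mod_cast h128
    rw [sub_pos, div_lt_one hk0]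
    linarith
  have h1 : F * (3 / 2 * k - 7 * (q * r)) * n < (3 / 2 * k - 7 * (q * r)) * minRank h :=
    lt_of_lt_of_le (by nlinarith) hmain
  have h2 : F * n < minRank h := by
    refine lt_of_mul_lt_mul_left (a := 3 / 2 * k - 7 * (q * r)) ?_ hpos.le
    linarith
  calc (2 : ℝ) ^ (k - 1) * F * (1 - 2 / (k : ℝ)) = F * (2 ^ (k - 1) * (1 - 2 / (k : ℝ))) := by ring
    _ ≤ F * n := by gcongr
    _ < minRank h := h2

theorem tendsto_log_div_sqrt :
    Tendsto (fun k : ℕ => Real.log k / √(k : ℝ)) atTop (𝓝 0) := by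
  have h := (isLittleO_log_rpow_atTop (r := 1 / 2) (by norm_num)).tendsto_div_nhds_zero
  have h2 := h.comp tendsto_natCast_atTop_atTop
  refine h2.congr fun k => ?_
  simp [Real.sqrt_eq_rpow]

theorem tendsto_log_div : Tendsto (fun k : ℕ => Real.log k / (k : ℝ)) atTop (𝓝 0) := by
  have h := (isLittleO_log_rpow_atTop (r := 1) (by norm_num)).tendsto_div_nhds_zero
  have h2 := h.comp tendsto_natCast_atTop_atTop
  refine h2.congr fun k => ?_
  simp

theorem eventually_sqrt_le :
    ∀ᶠ k : ℕ in atTop, 2 * √((k : ℝ) * Real.log k) / (k : ℝ) ≤ 1 / 4 := by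
  filter_upwards [tendsto_log_div.eventually_le_const (by norm_num : (0 : ℝ) < 1 / 64),
    eventually_ge_atTop 1] with k hk hk1
  have hk0 : (0 : ℝ) < k := by exact_mod_cast hk1
  rw [div_le_iff₀ hk0] at hk ⊢
  have : √((k : ℝ) * Real.log k) ≤ k / 8 := by
    apply Real.sqrt_le_iff.2
    constructor
    · positivity
    · nlinarith
  linarith

theorem exists_tendsto_lt_minRank_of_isExtremal :
    ∃ δ : ℕ → ℝ, Tendsto δ atTop (𝓝 0) ∧
      ∀ (k n : ℕ) (h : BoolFn n), 1 ≤ k → IsExtremal k h →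
        10 / 3 * (2 : ℝ) ^ (k - 1) * (1 + δ k) < minRank h := by
  classical
  -- The value -2 makes the bound negative at the `k` to which the explicit estimate does not apply.
  refine ⟨fun k => if 2 * √((k : ℝ) * Real.log k) / (k : ℝ) ≤ 1 / 4 then
    (1 - 1 / 2 * (2 * Real.log k / (√(k : ℝ) + 2 * Real.log k))) * (1 - 2 / (k : ℝ)) - 1
    else -2, ?_, ?_⟩
  · have h1 : Tendsto (fun k : ℕ => 2 * Real.log k / (√(k : ℝ) + 2 * Real.log k))
        atTop (𝓝 0) := by
      have h2 := tendsto_log_div_sqrt.const_mul 2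
      rw [mul_zero] at h2
      refine squeeze_zero' (Eventually.of_forall fun k => ?_) ?_ h2
      · have := Real.log_natCast_nonneg k
        positivity
      · filter_upwards [eventually_ge_atTop 1] with k hk
        have hk0 : (0 : ℝ) < k := by exact_mod_cast hk
        have hq : 0 < √(k : ℝ) := Real.sqrt_pos.2 hk0
        have := Real.log_natCast_nonneg k
        rw [← mul_div_assoc]
        gcongr
        linarith
    have h3 : Tendsto (fun k : ℕ => 2 / (k : ℝ)) atTop (𝓝 0) :=
      tendsto_const_nhds.div_atTop tendsto_natCast_atTop_atTop
    have h4 := (((h1.const_mul (1 / 2)).const_sub 1).mul (h3.const_sub 1)).sub_const 1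
    norm_num at h4
    refine h4.congr' ?_
    filter_upwards [eventually_sqrt_le] with k hk
    rw [if_pos hk]
  · intro k n h hk hh
    beta_reduce
    split_ifs with hc
    · refine lt_of_eq_of_lt ?_ (hh.lt_minRank hk hc)
      ring
    · refine lt_of_lt_of_le ?_ (Nat.cast_nonneg _)
      have : (0 : ℝ) < 2 ^ (k - 1) := by positivity
      linarith

/-! ### DNFs of complete functions as systems of covers. -/

theorem HasReducedColumns.falseRows_injective {k n : ℕ} {M : Matrix (Fin k) (Fin n) Bool}
    (h : HasReducedColumns M) : Function.Injective (falseRows M) := by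
  rintro ⟨j, σ⟩ ⟨j', σ'⟩ he
  have hmem : ∀ i, M i j ≠ σ ↔ M i j' ≠ σ' := by
    intro i
    have := congrArg (i ∈ ·) he
    simpa [mem_falseRows] using this
  by_cases hj : j = j'
  · subst hj
    obtain ⟨i, -⟩ := h.exists_one j
    have := hmem i
    refine Prod.ext rfl ?_
    revert this
    cases M i j <;> cases σ <;> cases σ' <;> simp
  · exfalso
    by_cases hσ : σ = σ'
    · subst hσ
      obtain ⟨i, hi⟩ := h.distinct j j' hj
      have := hmem i
      revert this hi
      cases M i j <;> cases M i j' <;> cases σ <;> simp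
    · obtain ⟨i, hi⟩ := h.not_negation j j'
      have := hmem i
      revert this hi hσ
      cases M i j <;> cases M i j' <;> cases σ <;> cases σ' <;> simp

theorem HasReducedColumns.exists_falseRows_eq {k : ℕ}
    {M : Matrix (Fin k) (Fin (2 ^ (k - 1) - 1)) Bool} (h : HasReducedColumns M)
    {A : Finset (Fin k)} (hA : A.Nonempty) (hA' : A ≠ Finset.univ) :
    ∃ l : Lit (2 ^ (k - 1) - 1), falseRows M l = A := by
  classical
  obtain ⟨i₀, hi₀⟩ := hA
  obtain ⟨i₁, hi₁⟩ : ∃ i, i ∉ A := by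
    by_contra! hcon
    exact hA' (Finset.eq_univ_iff_forall.2 hcon)
  -- The normalised columns are distinct and as many as the non-zero vectors vanishing at `i₀`, so
  -- they are all of these.
  have himg : Finset.univ.image (fun (j : Fin (2 ^ (k - 1) - 1)) (i : Fin k) =>
      xor (M i j) (M i₀ j)) = columnsOf i₀ fun _ => True := by
    apply Finset.eq_of_subset_of_card_le
    · intro v hv
      obtain ⟨j, -, rfl⟩ := Finset.mem_image.1 hv
      refine mem_columnsOf.2 ⟨?_, by simp, trivial⟩
      cases h0 : M i₀ j
      · obtain ⟨i, hi⟩ := h.exists_one j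
        exact ⟨i, by simp [hi]⟩
      · obtain ⟨i, hi⟩ := h.exists_zero j
        exact ⟨i, by simp [hi]⟩
    · rw [Finset.card_image_of_injective _ (h.injective_xor i₀), card_columnsOf_true,
        Finset.card_univ, Fintype.card_fin]
  have hv : (fun i => decide (i ∉ A)) ∈ columnsOf i₀ fun _ => True :=
    mem_columnsOf.2 ⟨⟨i₁, by simpa using hi₁⟩, by simpa using hi₀, trivial⟩
  rw [← himg] at hv
  obtain ⟨j, -, hj⟩ := Finset.mem_image.1 hv
  refine ⟨(j, !M i₀ j), ?_⟩
  ext i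
  have h1 : xor (M i j) (M i₀ j) = decide (i ∉ A) := congrFun hj i
  rw [mem_falseRows]
  by_cases hi : i ∈ A
  · simp only [hi, not_true_eq_false, decide_false] at h1
    revert h1
    cases M i j <;> cases M i₀ j <;> simp [hi]
  · simp only [hi, not_false_eq_true, decide_true] at h1
    revert h1
    cases M i j <;> cases M i₀ j <;> simp [hi]

/-- A family of covers of `Fin k` by proper non-empty sets which meets every choice `F` of one
set from each complementary pair, unless `F` consists of the sets without some point `i`. -/
structure IsCoverSystem {k : ℕ} (𝒟 : Finset (Finset (Finset (Fin k)))) : Prop where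
  nonempty : ∀ 𝒦 ∈ 𝒟, ∀ A ∈ 𝒦, A.Nonempty
  ne_univ : ∀ 𝒦 ∈ 𝒟, ∀ A ∈ 𝒦, A ≠ Finset.univ
  ne_compl : ∀ 𝒦 ∈ 𝒟, ∀ A ∈ 𝒦, ∀ B ∈ 𝒦, B ≠ Aᶜ
  cover : ∀ 𝒦 ∈ 𝒟, ∀ i, ∃ A ∈ 𝒦, i ∈ A
  choice : ∀ F : Finset (Fin k) → Prop,
    (∀ A : Finset (Fin k), A.Nonempty → A ≠ Finset.univ → (F Aᶜ ↔ ¬ F A)) →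
    (∃ 𝒦 ∈ 𝒟, ∀ A ∈ 𝒦, F A) ∨
      ∃ i, ∀ A : Finset (Fin k), A.Nonempty → A ≠ Finset.univ → i ∉ A → F A

theorem IsCoverSystem.minRank_le {k : ℕ} {𝒟 : Finset (Finset (Finset (Fin k)))}
    (h𝒟 : IsCoverSystem 𝒟) {φ : BoolFn (2 ^ (k - 1) - 1)} (hφ : IsCompleteFn k φ) :
    minRank φ ≤ ∑ 𝒦 ∈ 𝒟, 𝒦.card := by
  classical
  obtain ⟨M, hM, hred⟩ := hφ
  set lits : Finset (Finset (Fin k)) → Conj (2 ^ (k - 1) - 1) :=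
    fun 𝒦 => Finset.univ.filter fun l => falseRows M l ∈ 𝒦 with hlits
  have hmem : ∀ 𝒦 l, l ∈ lits 𝒦 ↔ falseRows M l ∈ 𝒦 := fun 𝒦 l => by simp [hlits]
  have hneg : ∀ j σ, falseRows M (j, !σ) = (falseRows M (j, σ))ᶜ := by
    intro j σ
    ext i
    rw [Finset.mem_compl, mem_falseRows, mem_falseRows]
    cases M i j <;> cases σ <;> simp
  have hreal : DNF.Realizes (𝒟.image lits) φ := by
    constructor
    · intro K hK j hj
      obtain ⟨𝒦, h𝒦, rfl⟩ := Finset.mem_image.1 hK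
      rw [hmem, hmem] at hj
      exact h𝒟.ne_compl 𝒦 h𝒦 _ hj.1 _ hj.2 (hneg j true)
    · intro x
      constructor
      · intro hx
        -- `F A` says that the literal with false rows `A` is true at `x`. The exceptional
        -- alternative in `choice` says that `x` is row `i`.
        have hch := h𝒟.choice (fun A => ∀ l, falseRows M l = A → x l.1 = l.2) (by
          intro A hA hA'
          obtain ⟨⟨j, σ⟩, rfl⟩ := hred.exists_falseRows_eq hA hA'
          rw [← hneg]
          constructor
          · intro h1 h2
            have e1 := h1 _ rfl
            have e2 := h2 _ rfl
            simp only at e1 e2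
            rw [e2] at e1
            revert e1
            cases σ <;> simp
          · intro h1 l hl
            obtain rfl := hred.falseRows_injective hl
            by_contra h2
            apply h1
            intro l hl
            obtain rfl := hred.falseRows_injective hl
            simpa using h2)
        rcases hch with ⟨𝒦, h𝒦, hF⟩ | ⟨i, hi⟩
        · exact ⟨lits 𝒦, Finset.mem_image_of_mem _ h𝒦, fun l hl => hF _ ((hmem _ _).1 hl) l rfl⟩
        · exfalso
          have : φ x = false := by
            rw [hM.2]
            refine ⟨i, ?_⟩
            funext j
            have hi' : i ∉ falseRows M (j, M i j) := by simp [mem_falseRows]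
            refine (hi (falseRows M (j, M i j)) ?_
              (fun h => hi' (by rw [h]; exact Finset.mem_univ i)) hi' (j, M i j) rfl).symm
            cases h0 : M i j
            · obtain ⟨i', hi'⟩ := hred.exists_one j
              exact ⟨i', by simp [mem_falseRows, hi']⟩
            · obtain ⟨i', hi'⟩ := hred.exists_zero j
              exact ⟨i', by simp [mem_falseRows, hi']⟩
          simp [this] at hx
      · rintro ⟨K, hK, hx⟩
        obtain ⟨𝒦, h𝒦, rfl⟩ := Finset.mem_image.1 hK
        by_contra hne
        obtain ⟨i, rfl⟩ := (hM.2 x).1 (Bool.eq_false_iff.2 hne)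
        obtain ⟨A, hA, hiA⟩ := h𝒟.cover 𝒦 h𝒦 i
        obtain ⟨l, rfl⟩ := hred.exists_falseRows_eq (h𝒟.nonempty 𝒦 h𝒦 A hA)
          (h𝒟.ne_univ 𝒦 h𝒦 A hA)
        exact mem_falseRows.1 hiA (hx l ((hmem _ _).2 hA))
  refine (_root_.minRank_le hreal).trans ?_
  refine (Finset.sum_image_le_of_nonneg (g := lits)
    (f := fun K : Finset (Lit (2 ^ (k - 1) - 1)) => K.card) (fun _ _ => Nat.zero_le _)).trans ?_
  refine Finset.sum_le_sum fun 𝒦 _ => ?_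
  exact Finset.card_le_card_of_injOn (falseRows M) (fun l hl => (hmem _ _).1 hl)
    hred.falseRows_injective.injOn

/-! ### Propagation through partitions with a singleton. -/

/-- A set of pairs `(A, c)`, each standing for the partition `A`, `{c}`, `(insert c A)ᶜ`, such
that every non-empty set with at least two points in its complement occurs in a partition. -/
structure IsEdgeCover {k : ℕ} (E : Finset (Finset (Fin k) × Fin k)) : Prop where
  nonempty : ∀ e ∈ E, e.1.Nonempty
  not_mem : ∀ e ∈ E, e.2 ∉ e.1
  ne_univ : ∀ e ∈ E, insert e.2 e.1 ≠ Finset.univ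
  covers : ∀ X : Finset (Fin k), X.Nonempty → X.card + 2 ≤ k →
    ∃ e ∈ E, e.1 = X ∨ (insert e.2 e.1)ᶜ = X

/-- The covers belonging to the pairs in `E`, the cover by singletons, and the covers by two
complements of singletons. -/
def coverSystem {k : ℕ} (E : Finset (Finset (Fin k) × Fin k)) :
    Finset (Finset (Finset (Fin k))) :=
  (E.image fun e => {e.1, {e.2}, (insert e.2 e.1)ᶜ}) ∪
    ({Finset.univ.image fun c => {c}} ∪
      (Finset.univ.offDiag.image fun p : Fin k × Fin k => {{p.1}ᶜ, {p.2}ᶜ}))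

theorem sum_card_coverSystem_le {k : ℕ} (E : Finset (Finset (Fin k) × Fin k)) :
    ∑ 𝒦 ∈ coverSystem E, 𝒦.card ≤ 3 * E.card + (k + 2 * k ^ 2) := by
  have hu : ∀ s t : Finset (Finset (Finset (Fin k))), ∑ 𝒦 ∈ s ∪ t, 𝒦.card ≤
      ∑ 𝒦 ∈ s, 𝒦.card + ∑ 𝒦 ∈ t, 𝒦.card := fun s t => by
    rw [← Finset.sum_union_inter]
    exact Nat.le_add_right _ _
  refine (hu _ _).trans (Nat.add_le_add ?_ ((hu _ _).trans (Nat.add_le_add ?_ ?_)))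
  · refine (Finset.sum_le_card_nsmul _ _ 3 ?_).trans ?_
    · intro 𝒦 h
      obtain ⟨e, -, rfl⟩ := Finset.mem_image.1 h
      exact Finset.card_le_three
    · rw [smul_eq_mul, mul_comm]
      exact Nat.mul_le_mul_left _ Finset.card_image_le
  · rw [Finset.sum_singleton]
    exact Finset.card_image_le.trans (by simp)
  · refine (Finset.sum_le_card_nsmul _ _ 2 ?_).trans ?_
    · intro 𝒦 h
      obtain ⟨e, -, rfl⟩ := Finset.mem_image.1 h
      exact Finset.card_le_two
    · rw [smul_eq_mul, mul_comm]
      refine Nat.mul_le_mul_left _ (Finset.card_image_le.trans ?_)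
      rw [Finset.offDiag_card, Finset.card_univ, Fintype.card_fin, sq]
      exact Nat.sub_le _ _

theorem IsEdgeCover.isCoverSystem {k : ℕ} (hk : 3 ≤ k) {E : Finset (Finset (Fin k) × Fin k)}
    (hE : IsEdgeCover E) : IsCoverSystem (coverSystem E) := by
  have hcases : ∀ {p : Finset (Finset (Fin k)) → Prop},
      (∀ e ∈ E, p {e.1, {e.2}, (insert e.2 e.1)ᶜ}) → p (Finset.univ.image fun c => {c}) →
      (∀ a b, a ≠ b → p {{a}ᶜ, {b}ᶜ}) → ∀ 𝒦 ∈ coverSystem E, p 𝒦 := by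
    intro p h1 h2 h3 𝒦 h
    rw [coverSystem, Finset.mem_union, Finset.mem_union, Finset.mem_singleton] at h
    rcases h with h | rfl | h
    · obtain ⟨e, he, rfl⟩ := Finset.mem_image.1 h
      exact h1 e he
    · exact h2
    · obtain ⟨e, he, rfl⟩ := Finset.mem_image.1 h
      exact h3 _ _ (Finset.mem_offDiag.1 he).2.2
  have hcard1 : ∀ a : Fin k, ({a} : Finset (Fin k)).card = 1 := Finset.card_singleton
  have hcard2 : ∀ a : Fin k, ({a}ᶜ : Finset (Fin k)).card = k - 1 := fun a => by
    rw [Finset.card_compl, Finset.card_singleton, Fintype.card_fin]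
  have hsne : ∀ a : Fin k, ({a} : Finset (Fin k)) ≠ Finset.univ := fun a h => by
    have := congrArg Finset.card h
    rw [hcard1, Finset.card_univ, Fintype.card_fin] at this
    omega
  have hthird : ∀ e ∈ E, ∃ b, b ∉ insert e.2 e.1 := fun e he => by
    by_contra! hcon
    exact hE.ne_univ e he (Finset.eq_univ_iff_forall.2 hcon)
  constructor
  · apply hcases
    · intro e he A hA
      simp only [Finset.mem_insert, Finset.mem_singleton] at hA
      rcases hA with rfl | rfl | rfl
      · exact hE.nonempty e he
      · exact Finset.singleton_nonempty _
      · obtain ⟨b, hb⟩ := hthird e he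
        exact ⟨b, Finset.mem_compl.2 hb⟩
    · intro A hA
      obtain ⟨c, -, rfl⟩ := Finset.mem_image.1 hA
      exact Finset.singleton_nonempty _
    · intro a b hab A hA
      simp only [Finset.mem_insert, Finset.mem_singleton] at hA
      rcases hA with rfl | rfl
      · exact ⟨b, by simpa using hab.symm⟩
      · exact ⟨a, by simpa using hab⟩
  · apply hcases
    · intro e he A hA
      simp only [Finset.mem_insert, Finset.mem_singleton] at hA
      rcases hA with rfl | rfl | rfl
      · exact fun h => hE.not_mem e he (h ▸ Finset.mem_univ _)
      · exact hsne _
      · intro h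
        have : e.2 ∈ (insert e.2 e.1)ᶜ := h ▸ Finset.mem_univ _
        simp at this
    · intro A hA
      obtain ⟨c, -, rfl⟩ := Finset.mem_image.1 hA
      exact hsne c
    · intro a b hab A hA h
      simp only [Finset.mem_insert, Finset.mem_singleton] at hA
      have h2 := congrArg Finset.card h
      rw [Finset.card_univ, Fintype.card_fin] at h2
      rcases hA with rfl | rfl <;> rw [hcard2] at h2 <;> omega
  · apply hcases
    · intro e he A hA B hB h
      -- Each part contains exactly one of `a`, `e.2`, `b`, so the complement of a part contains two
      -- of them and is no part.
      obtain ⟨a, ha⟩ := hE.nonempty e he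
      obtain ⟨b, hb⟩ := hthird e he
      have hc := hE.not_mem e he
      have hac : a ≠ e.2 := fun h => hc (h ▸ ha)
      rw [Finset.mem_insert, not_or] at hb
      have e1 : a ∈ B ↔ a ∉ A := by rw [h, Finset.mem_compl]
      have e2 : b ∈ B ↔ b ∉ A := by rw [h, Finset.mem_compl]
      have e3 : e.2 ∈ B ↔ e.2 ∉ A := by rw [h, Finset.mem_compl]
      clear h
      simp only [Finset.mem_insert, Finset.mem_singleton] at hA hB
      rcases hA with rfl | rfl | rfl <;> rcases hB with rfl | rfl | rfl <;>
        simp [ha, hb.1, hb.2, hc, hac] at e1 e2 e3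
    · intro A hA B hB h
      obtain ⟨a, -, rfl⟩ := Finset.mem_image.1 hA
      obtain ⟨b, -, rfl⟩ := Finset.mem_image.1 hB
      have := congrArg Finset.card h
      rw [hcard1, hcard2] at this
      omega
    · intro a b hab A hA B hB h
      simp only [Finset.mem_insert, Finset.mem_singleton] at hA hB
      have hA2 : A.card = k - 1 := by rcases hA with rfl | rfl <;> exact hcard2 _
      have hB2 : B.card = k - 1 := by rcases hB with rfl | rfl <;> exact hcard2 _
      have := congrArg Finset.card h
      rw [Finset.card_compl, hA2, hB2, Fintype.card_fin] at this
      omega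
  · apply hcases
    · intro e he i
      by_cases h1 : i ∈ e.1
      · exact ⟨e.1, by simp, h1⟩
      · by_cases h2 : i = e.2
        · exact ⟨{e.2}, by simp, by simp [h2]⟩
        · exact ⟨(insert e.2 e.1)ᶜ, by simp, by simp [h1, h2]⟩
    · intro i
      exact ⟨{i}, Finset.mem_image_of_mem _ (Finset.mem_univ i), by simp⟩
    · intro a b hab i
      by_cases h : i = a
      · exact ⟨{b}ᶜ, by simp, by simpa [h] using hab⟩
      · exact ⟨{a}ᶜ, by simp, by simpa using h⟩
  · intro F hF
    by_contra! hcon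
    obtain ⟨hD, hpt⟩ := hcon
    have hD1 : ∀ e ∈ E, F e.1 → F {e.2} → ¬ F (insert e.2 e.1)ᶜ := by
      intro e he h1 h2 h3
      obtain ⟨A, hA, hn⟩ := hD _ (Finset.mem_union_left _ (Finset.mem_image_of_mem _ he))
      simp only [Finset.mem_insert, Finset.mem_singleton] at hA
      rcases hA with rfl | rfl | rfl <;> exact hn ‹_›
    -- The cover by singletons gives a singleton on which `F` fails; the covers by two complements
    -- of singletons make it unique.
    obtain ⟨i, hi⟩ : ∃ i : Fin k, ¬ F {i} := by
      obtain ⟨A, hA, hn⟩ := hD _ (Finset.mem_union_right _ (Finset.mem_union_left _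
        (Finset.mem_singleton_self _)))
      obtain ⟨c, -, rfl⟩ := Finset.mem_image.1 hA
      exact ⟨c, hn⟩
    have hsing : ∀ c, c ≠ i → F {c} := by
      intro c hc
      by_contra hn
      obtain ⟨A, hA, hA'⟩ := hD {{c}ᶜ, {i}ᶜ} (Finset.mem_union_right _ (Finset.mem_union_right _
        (Finset.mem_image.2 ⟨(c, i), by simp [hc], rfl⟩)))
      simp only [Finset.mem_insert, Finset.mem_singleton] at hA
      rcases hA with rfl | rfl
      · exact hA' ((hF _ (Finset.singleton_nonempty _) (hsne _)).2 hn)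
      · exact hA' ((hF _ (Finset.singleton_nonempty _) (hsne _)).2 hi)
    -- Induction on the size of the complement: a partition containing `A` and `{c}` with `c ≠ i`
    -- carries `F` from `A` to `insert c A`, up to the complement of a singleton, where `hsing`
    -- contradicts it.
    have key : ∀ m, ∀ A : Finset (Fin k), A.card + m = k → A ≠ Finset.univ → i ∈ A → ¬ F A := by
      intro m
      induction m with
      | zero =>
        intro A hA hne
        exact absurd (Finset.eq_univ_of_card A (by simpa using hA)) hne
      | succ m ih =>
        intro A hA hne hiA hFA
        rcases Nat.eq_zero_or_pos m with rfl | hm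
        · have h1 : Aᶜ.card = 1 := by
            rw [Finset.card_compl, Fintype.card_fin]
            omega
          obtain ⟨c, hc⟩ := Finset.card_eq_one.1 h1
          have h2 : A = {c}ᶜ := by rw [← hc, compl_compl]
          have hci : c ≠ i := by
            rintro rfl
            simp [h2] at hiA
          rw [h2] at hFA
          exact (hF _ (Finset.singleton_nonempty _) (hsne _)).1 hFA (hsing c hci)
        · obtain ⟨⟨B, c⟩, he, rfl | rfl⟩ := hE.covers A ⟨i, hiA⟩ (by omega)
          · have hc := hE.not_mem _ he
            have hu := hE.ne_univ _ he
            simp only at hc hu hA hiA hFA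
            have hci : c ≠ i := fun h => hc (h ▸ hiA)
            refine hD1 _ he hFA (hsing c hci) ?_
            rw [hF _ (Finset.insert_nonempty _ _) hu]
            refine ih _ ?_ hu (Finset.mem_insert_of_mem hiA)
            rw [Finset.card_insert_of_notMem hc]
            omega
          · have hc := hE.not_mem _ he
            have hn := hE.nonempty _ he
            simp only at hc hn hA hiA hFA
            have hci : c ≠ i := by
              rintro rfl
              simp at hiA
            have hBu : B ≠ Finset.univ := fun h => hc (h ▸ Finset.mem_univ _)
            have hFB : ¬ F Bᶜ := by
              refine ih _ ?_ (fun h => ?_) ?_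
              · rw [Finset.card_compl, Finset.card_insert_of_notMem hc, Fintype.card_fin] at hA
                rw [Finset.card_compl, Fintype.card_fin]
                have := Finset.card_lt_univ_of_notMem hc
                rw [Fintype.card_fin] at this
                omega
              · rw [Finset.compl_eq_univ_iff] at h
                exact hn.ne_empty h
              · rw [Finset.mem_compl] at hiA ⊢
                exact fun h => hiA (Finset.mem_insert_of_mem h)
            rw [hF _ hn hBu, not_not] at hFB
            exact hD1 _ he hFB (hsing c hci) hFA
    obtain ⟨A, hA, hA', hiA, hFA⟩ := hpt i
    have h1 : F Aᶜ := (hF A hA hA').2 hFA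
    refine key (k - Aᶜ.card) Aᶜ ?_ ?_ (Finset.mem_compl.2 hiA) h1
    · have := Finset.card_le_univ Aᶜ
      rw [Fintype.card_fin] at this
      omega
    · intro h
      rw [Finset.compl_eq_univ_iff] at h
      exact hA.ne_empty h

/-! ### Pairing sets by Hall's theorem. -/

/-- Above the middle level, the sets of size `r` can be shrunk by one point injectively. -/
theorem exists_injOn_erase {k r : ℕ} [NeZero k] (hr : k + 1 ≤ 2 * r) :
    ∃ d : Finset (Fin k) → Fin k, (∀ A, A.card = r → d A ∈ A) ∧
      ∀ A B : Finset (Fin k), A.card = r → B.card = r → A.erase (d A) = B.erase (d B) → A = B := by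
  classical
  set t : {A : Finset (Fin k) // A.card = r} → Finset (Finset (Fin k)) :=
    fun A => A.1.image A.1.erase with ht
  have hall : ∀ s : Finset {A : Finset (Fin k) // A.card = r}, s.card ≤ (s.biUnion t).card := by
    intro s
    have h1 : s.biUnion t = (s.map (Function.Embedding.subtype _)).shadow := by
      ext B
      simp only [ht, Finset.mem_biUnion, Finset.mem_image, Finset.mem_shadow_iff, Finset.mem_map,
        Function.Embedding.subtype_apply]
      constructor
      · rintro ⟨A, hA, a, ha, rfl⟩
        exact ⟨A.1, ⟨A, hA, rfl⟩, a, ha, rfl⟩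
      · rintro ⟨_, ⟨A, hA, rfl⟩, a, ha, rfl⟩
        exact ⟨A, hA, a, ha, rfl⟩
    -- Hall's condition: the local LYM inequality compares a family with its shadow in the ratio `r`
    -- to `k - r + 1`, and `r` is the larger.
    have h2 := Finset.local_lubell_yamamoto_meshalkin_inequality_mul (r := r)
      (𝒜 := s.map (Function.Embedding.subtype _)) (by
        intro A hA
        obtain ⟨A', -, rfl⟩ := Finset.mem_map.1 (Finset.mem_coe.1 hA)
        exact A'.2)
    rw [← h1, Finset.card_map, Fintype.card_fin] at h2
    have h3 : k - r + 1 ≤ r := by omega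
    have h4 := h2.trans (Nat.mul_le_mul_left _ h3)
    exact Nat.le_of_mul_le_mul_right h4 (by omega)
  obtain ⟨f, hf, hft⟩ := (Finset.all_card_le_biUnion_card_iff_exists_injective t).1 hall
  have hex : ∀ A : {A : Finset (Fin k) // A.card = r}, ∃ a, a ∈ A.1 ∧ A.1.erase a = f A := by
    intro A
    simpa [ht] using hft A
  choose g hg hgf using hex
  have hex' : ∀ A : Finset (Fin k), ∃ a : Fin k, ∀ h : A.card = r, a = g ⟨A, h⟩ := by
    intro A
    by_cases h : A.card = r
    · exact ⟨g ⟨A, h⟩, fun _ => rfl⟩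
    · exact ⟨0, fun h' => absurd h' h⟩
  choose d hd using hex'
  refine ⟨d, fun A hA => ?_, fun A B hA hB he => ?_⟩
  · rw [hd A hA]
    exact hg ⟨A, hA⟩
  · rw [hd A hA, hd B hB] at he
    have h1 : f ⟨A, hA⟩ = f ⟨B, hB⟩ := by rw [← hgf, ← hgf, he]
    exact congrArg Subtype.val (hf h1)

theorem exists_isEdgeCover {k : ℕ} (hk : 3 ≤ k) :
    ∃ E : Finset (Finset (Fin k) × Fin k), IsEdgeCover E ∧
      E.card ≤ (Finset.univ.filter fun A : Finset (Fin k) => k ≤ 2 * A.card + 1).card := by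
  classical
  have : NeZero k := ⟨by omega⟩
  have hex : ∀ r, ∃ d : Finset (Fin k) → Fin k, k + 2 ≤ 2 * r → (∀ A, A.card = r → d A ∈ A) ∧
      ∀ A B : Finset (Fin k), A.card = r → B.card = r → A.erase (d A) = B.erase (d B) → A = B := by
    intro r
    by_cases hr : k + 2 ≤ 2 * r
    · obtain ⟨d, hd⟩ := exists_injOn_erase (k := k) (r := r) (by omega)
      exact ⟨d, fun _ => hd⟩
    · exact ⟨fun _ => 0, fun h => absurd h hr⟩
  choose d' hd' using hex
  set d : Finset (Fin k) → Fin k := fun A => d' A.card A with hd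
  set U : Finset (Finset (Fin k)) := Finset.univ.filter fun A => k + 2 ≤ 2 * A.card with hU
  set X : Finset (Finset (Fin k)) := Finset.univ.filter fun A => k ≤ 2 * A.card + 1 with hX
  have hmU : ∀ A, A ∈ U ↔ k + 2 ≤ 2 * A.card := fun A => by simp [hU]
  have hmX : ∀ A, A ∈ X ↔ k ≤ 2 * A.card + 1 := fun A => by simp [hX]
  have hdm : ∀ A ∈ U, d A ∈ A := fun A hA => (hd' A.card ((hmU A).1 hA)).1 A rfl
  have hcard : ∀ A ∈ U, (A.erase (d A)).card + 1 = A.card := fun A hA =>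
    Finset.card_erase_add_one (hdm A hA)
  have hinj : Set.InjOn (fun A : Finset (Fin k) => A.erase (d A)) U := by
    intro A hA B hB he
    have h1 := hcard A hA
    have h2 := hcard B hB
    simp only at he
    rw [he] at h1
    have h3 : B.card = A.card := by omega
    refine (hd' A.card ((hmU A).1 hA)).2 A B rfl h3 ?_
    simp only [hd, h3] at he
    exact he
  set I := U.image fun A => A.erase (d A) with hI
  have hIX : I ⊆ X := by
    intro B hB
    obtain ⟨A, hA, rfl⟩ := Finset.mem_image.1 hB
    have := hcard A hA
    rw [hmU] at hA
    rw [hmX]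
    omega
  have hout : ∀ A : Finset (Fin k), ∃ c, A ≠ Finset.univ → c ∉ A := by
    intro A
    by_cases h : A = Finset.univ
    · exact ⟨0, fun h' => absurd h h'⟩
    · obtain ⟨c, hc⟩ : ∃ c, c ∉ A := by
        by_contra! hcon
        exact h (Finset.eq_univ_iff_forall.2 hcon)
      exact ⟨c, fun _ => hc⟩
  choose u hu using hout
  -- The partition from `A` serves both `Aᶜ`, which runs through the small sets, and `A.erase (d
  -- A)`. Members of `X` outside the image `I` get a partition each in `E₂`, so the total is at most
  -- the size of `X`.
  set E₁ := (U.erase Finset.univ).image fun A => (A.erase (d A), d A) with hE₁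
  set E₂ := ((X \ I).filter fun A => A.card + 2 ≤ k).image fun A => (A, u A) with hE₂
  have hne_univ : ∀ A : Finset (Fin k), A.card < k → A ≠ Finset.univ := by
    rintro A h rfl
    simp at h
  have hcases : ∀ {p : Finset (Fin k) × Fin k → Prop},
      (∀ A ∈ U, A ≠ Finset.univ → p (A.erase (d A), d A)) →
      (∀ A, k ≤ 2 * A.card + 1 → A.card + 2 ≤ k → p (A, u A)) → ∀ e ∈ E₁ ∪ E₂, p e := by
    intro p h1 h2 e he
    rcases Finset.mem_union.1 he with he | he
    · obtain ⟨A, hA, rfl⟩ := Finset.mem_image.1 he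
      exact h1 A (Finset.mem_of_mem_erase hA) (Finset.ne_of_mem_erase hA)
    · obtain ⟨A, hA, rfl⟩ := Finset.mem_image.1 he
      rw [Finset.mem_filter, Finset.mem_sdiff, hmX] at hA
      exact h2 A hA.1.1 hA.2
  refine ⟨E₁ ∪ E₂, ⟨?_, ?_, ?_, ?_⟩, ?_⟩
  · apply hcases
    · intro A hA _
      have := hcard A hA
      rw [hmU] at hA
      exact Finset.card_pos.1 (by omega : 0 < (A.erase (d A)).card)
    · intro A h1 h2
      exact Finset.card_pos.1 (by omega : 0 < A.card)
  · apply hcases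
    · intro A _ _
      exact Finset.notMem_erase _ _
    · intro A h1 h2
      exact hu A (hne_univ A (by omega))
  · apply hcases
    · intro A hA hA'
      rwa [Finset.insert_erase (hdm A hA)]
    · intro A h1 h2
      apply hne_univ
      rw [Finset.card_insert_of_notMem (hu A (hne_univ A (by omega)))]
      omega
  · intro Y hY hYk
    have hYc : Yᶜ.card = k - Y.card := by rw [Finset.card_compl, Fintype.card_fin]
    by_cases h2 : 2 * Y.card + 2 ≤ k
    · have hYU : Yᶜ ∈ U := by
        rw [hmU]
        omega
      refine ⟨_, Finset.mem_union_left _ (Finset.mem_image_of_mem _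
        (Finset.mem_erase.2 ⟨?_, hYU⟩)), Or.inr ?_⟩
      · rw [Ne, Finset.compl_eq_univ_iff]
        exact hY.ne_empty
      · rw [Finset.insert_erase (hdm _ hYU), compl_compl]
    · by_cases hYI : Y ∈ I
      · obtain ⟨A, hA, rfl⟩ := Finset.mem_image.1 hYI
        refine ⟨_, Finset.mem_union_left _ (Finset.mem_image_of_mem _
          (Finset.mem_erase.2 ⟨?_, hA⟩)), Or.inl rfl⟩
        apply hne_univ
        have := hcard A hA
        omega
      · refine ⟨_, Finset.mem_union_right _ (Finset.mem_image_of_mem _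
          (Finset.mem_filter.2 ⟨Finset.mem_sdiff.2 ⟨?_, hYI⟩, hYk⟩)), Or.inl rfl⟩
        rw [hmX]
        omega
  · have h1 : E₁.card ≤ I.card := by
      rw [hI, Finset.card_image_of_injOn hinj]
      exact Finset.card_image_le.trans (Finset.card_le_card (Finset.erase_subset _ _))
    have h2 : E₂.card ≤ (X \ I).card :=
      Finset.card_image_le.trans (Finset.card_le_card (Finset.filter_subset _ _))
    have h3 := Finset.card_sdiff_add_card_eq_card hIX
    have h4 := Finset.card_union_le E₁ E₂
    omega

/-- Complementation shows that the sets with more than `k / 2` points are at most half of all; what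
remains has exactly `⌊k / 2⌋` points. -/
theorem card_filter_le_two_mul_card_add_one {k : ℕ} (hk : 1 ≤ k) :
    (Finset.univ.filter fun A : Finset (Fin k) => k ≤ 2 * A.card + 1).card ≤
      2 ^ (k - 1) + k.choose (k / 2) := by
  classical
  set L := Finset.univ.filter fun A : Finset (Fin k) => k < 2 * A.card with hL
  have hsub : (Finset.univ.filter fun A : Finset (Fin k) => k ≤ 2 * A.card + 1) ⊆
      L ∪ Finset.powersetCard (k / 2) Finset.univ := by
    intro A hA
    have := (Finset.mem_filter.1 hA).2
    rw [Finset.mem_union, hL, Finset.mem_filter, Finset.mem_powersetCard]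
    by_cases h : k < 2 * A.card
    · exact Or.inl ⟨Finset.mem_univ _, h⟩
    · exact Or.inr ⟨Finset.subset_univ _, by omega⟩
  have h1 := (Finset.card_le_card hsub).trans (Finset.card_union_le _ _)
  rw [Finset.card_powersetCard, Finset.card_univ, Fintype.card_fin] at h1
  have h2 : L.card ≤ Lᶜ.card := by
    refine Finset.card_le_card_of_injOn (fun A => Aᶜ) (fun A hA => ?_) compl_injective.injOn
    have hA' := (Finset.mem_filter.1 hA).2
    have h3 := Finset.card_compl A
    rw [Fintype.card_fin] at h3
    simp only [hL, Finset.coe_compl, Set.mem_compl_iff, Finset.mem_coe, Finset.mem_filter,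
      Finset.mem_univ, true_and]
    omega
  have h3 := Finset.card_add_card_compl L
  rw [Fintype.card_finset, Fintype.card_fin] at h3
  have h4 : 2 ^ k = 2 * 2 ^ (k - 1) := by
    rw [← pow_succ']
    congr 1
    omega
  omega

theorem minRank_le_of_isCompleteFn {k : ℕ} (hk : 3 ≤ k) {φ : BoolFn (2 ^ (k - 1) - 1)}
    (hφ : IsCompleteFn k φ) :
    minRank φ ≤ 3 * (2 ^ (k - 1) + k.choose (k / 2)) + (k + 2 * k ^ 2) := by
  obtain ⟨E, hE, hc⟩ := exists_isEdgeCover hk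
  have h1 := (hE.isCoverSystem hk).minRank_le hφ
  have h2 := sum_card_coverSystem_le E
  have h3 := card_filter_le_two_mul_card_add_one (k := k) (by omega)
  omega

/-! ### The middle binomial coefficient is negligible against 2^k. -/

/-- The induction step reduces to `(2 * n + 1) * (2 * n + 3) ≤ 4 * (n + 1) ^ 2`. -/
theorem centralBinom_sq_mul_le (n : ℕ) : n.centralBinom ^ 2 * (2 * n + 1) ≤ 16 ^ n := by
  induction n with
  | zero => simp
  | succ n ih =>
    have h := Nat.succ_mul_centralBinom_succ n
    have h1 : (n + 1) ^ 2 * ((n + 1).centralBinom ^ 2 * (2 * (n + 1) + 1)) =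
        4 * (2 * n + 1) * (2 * n + 3) * (n.centralBinom ^ 2 * (2 * n + 1)) := by
      calc (n + 1) ^ 2 * ((n + 1).centralBinom ^ 2 * (2 * (n + 1) + 1))
          = ((n + 1) * (n + 1).centralBinom) ^ 2 * (2 * n + 3) := by ring
        _ = _ := by rw [h]; ring
    have h2 : 4 * (2 * n + 1) * (2 * n + 3) ≤ 16 * (n + 1) ^ 2 := by nlinarith
    have h3 := Nat.mul_le_mul h2 ih
    rw [← h1] at h3
    refine le_of_mul_le_mul_left ?_ (pow_pos (by omega : 0 < n + 1) 2)
    calc _ ≤ _ := h3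
      _ = _ := by ring

theorem choose_half_sq_mul_le (k : ℕ) : k.choose (k / 2) ^ 2 * (k + 1) ≤ 4 ^ k := by
  obtain ⟨n, rfl | rfl⟩ := Nat.even_or_odd' k
  · have h := centralBinom_sq_mul_le n
    rw [Nat.mul_div_cancel_left n two_pos, pow_mul]
    exact h
  · have h := centralBinom_sq_mul_le (n + 1)
    have h1 : (n + 1).centralBinom = 2 * (2 * n + 1).choose n := by
      rw [Nat.centralBinom, show 2 * (n + 1) = (2 * n + 1) + 1 by ring, Nat.choose_succ_succ,
        Nat.choose_symm_half]
      ring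
    rw [show (2 * n + 1) / 2 = n by omega]
    have h2 : (4 : ℕ) ^ (2 * n + 1) * 4 = 16 ^ (n + 1) := by
      rw [← pow_succ, show 2 * n + 1 + 1 = 2 * (n + 1) by ring, pow_mul]
      norm_num
    rw [h1, ← h2] at h
    nlinarith

theorem tendsto_choose_half_div_two_pow :
    Tendsto (fun k : ℕ => (k.choose (k / 2) : ℝ) / 2 ^ (k - 1)) atTop (𝓝 0) := by
  have h1 : Tendsto (fun k : ℕ => 2 * √(1 / ((k : ℝ) + 1))) atTop (𝓝 0) := by
    have := (Real.continuous_sqrt.tendsto 0).comp (tendsto_one_div_add_atTop_nhds_zero_nat (𝕜 := ℝ))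
    simpa using this.const_mul 2
  refine squeeze_zero' (Eventually.of_forall fun k => by positivity) ?_ h1
  filter_upwards [eventually_ge_atTop 1] with k hk
  have h2 : ((k.choose (k / 2) : ℝ)) ^ 2 * (k + 1) ≤ 4 ^ k := by
    exact_mod_cast choose_half_sq_mul_le k
  have h3 : (2 : ℝ) ^ k = 2 * 2 ^ (k - 1) := by
    rw [← pow_succ']
    congr 1
    omega
  have h4 : (4 : ℝ) ^ k = ((2 : ℝ) ^ k) ^ 2 := by
    rw [← pow_mul, mul_comm, pow_mul]
    norm_num
  have h5 : (k.choose (k / 2) : ℝ) / 2 ^ k ≤ √(1 / ((k : ℝ) + 1)) := by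
    apply Real.le_sqrt_of_sq_le
    rw [div_pow, div_le_div_iff₀ (by positivity) (by positivity), ← h4]
    linarith
  calc (k.choose (k / 2) : ℝ) / 2 ^ (k - 1) = 2 * (k.choose (k / 2) / 2 ^ k) := by
        rw [h3]
        field_simp
    _ ≤ _ := by gcongr

/-! ### Asymptotic upper bound and comparison. -/

theorem exists_tendsto_minRank_le_of_isCompleteFn :
    ∃ δ : ℕ → ℝ, Tendsto δ atTop (𝓝 0) ∧
      ∀ (k : ℕ) (φ : BoolFn (2 ^ (k - 1) - 1)), 1 ≤ k → IsCompleteFn k φ →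
        (minRank φ : ℝ) ≤ 3 * (2 : ℝ) ^ (k - 1) * (1 + δ k) := by
  classical
  -- For `k < 3` the sum over all functions bounds each rank without depending on `φ`.
  refine ⟨fun k => if 3 ≤ k then
    k.choose (k / 2) / 2 ^ (k - 1) + (k + 2 * (k : ℝ) ^ 2) / (3 * 2 ^ (k - 1))
    else ∑ φ : BoolFn (2 ^ (k - 1) - 1), (minRank φ : ℝ), ?_, ?_⟩
  · have hp : ∀ m : ℕ, Tendsto (fun k : ℕ => (k : ℝ) ^ m / 2 ^ k) atTop (𝓝 0) := fun m =>
      tendsto_pow_const_div_const_pow_of_one_lt m (by norm_num)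
    have h1 := tendsto_choose_half_div_two_pow.add
      (((hp 1).const_mul (2 / 3)).add ((hp 2).const_mul (4 / 3)))
    norm_num at h1
    refine h1.congr' ?_
    filter_upwards [eventually_ge_atTop 3] with k hk
    have h3 : (2 : ℝ) ^ k = 2 * 2 ^ (k - 1) := by
      rw [← pow_succ']
      congr 1
      omega
    rw [if_pos hk, h3]
    field_simp
    ring
  · intro k φ hk hφ
    have hX : (1 : ℝ) ≤ 2 ^ (k - 1) := one_le_pow₀ (by norm_num)
    beta_reduce
    split_ifs with h3
    · have h1 : (minRank φ : ℝ) ≤ 3 * (2 ^ (k - 1) + k.choose (k / 2)) + (k + 2 * (k : ℝ) ^ 2) := by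
        exact_mod_cast minRank_le_of_isCompleteFn h3 hφ
      refine h1.trans (le_of_eq ?_)
      field_simp
      ring
    · have h1 : (minRank φ : ℝ) ≤ ∑ φ : BoolFn (2 ^ (k - 1) - 1), (minRank φ : ℝ) :=
        Finset.single_le_sum (f := fun φ : BoolFn (2 ^ (k - 1) - 1) => (minRank φ : ℝ))
          (fun _ _ => Nat.cast_nonneg _) (Finset.mem_univ φ)
      have h0 : (0 : ℝ) ≤ minRank φ := Nat.cast_nonneg _
      nlinarith

theorem eventually_mul_minRank_lt {c : ℝ} (hc : c < 10 / 9) :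
    ∀ᶠ k : ℕ in atTop, ∀ (n : ℕ) (h : BoolFn n) (φ : BoolFn (2 ^ (k - 1) - 1)),
      IsExtremal k h → IsCompleteFn k φ → c * (minRank φ : ℝ) < minRank h := by
  obtain ⟨δ, hδ, hlow⟩ := exists_tendsto_lt_minRank_of_isExtremal
  obtain ⟨ε, hε, hup⟩ := exists_tendsto_minRank_le_of_isCompleteFn
  -- Replacing `c` by `max c 0` allows multiplication of the upper bound; the limit in `h1` is `10 /
  -- 3 - 3 * max c 0`, which is positive.
  have hb : max c 0 < 10 / 9 := max_lt hc (by norm_num)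
  have h1 : Tendsto (fun k => 10 / 3 * (1 + δ k) - max c 0 * (3 * (1 + ε k))) atTop
      (𝓝 (10 / 3 * (1 + 0) - max c 0 * (3 * (1 + 0)))) :=
    ((hδ.const_add 1).const_mul _).sub (((hε.const_add 1).const_mul _).const_mul _)
  filter_upwards [h1.eventually (lt_mem_nhds (a := 0) (by linarith)), eventually_ge_atTop 1]
    with k hk hk1 n h φ hh hφ
  have hX : (0 : ℝ) < 2 ^ (k - 1) := by positivity
  calc c * (minRank φ : ℝ) ≤ max c 0 * minRank φ := by
        gcongr
        exact le_max_left _ _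
    _ ≤ max c 0 * (3 * (2 : ℝ) ^ (k - 1) * (1 + ε k)) := by
        gcongr
        exact hup k φ hk1 hφ
    _ ≤ 10 / 3 * (2 : ℝ) ^ (k - 1) * (1 + δ k) := by nlinarith
    _ < minRank h := hlow k n h hk1 hh

theorem mainTheorem3 :
    -- the functions `h` and the complete functions exist
    (∀ k : ℕ, 1 ≤ k → ∃ (n : ℕ) (h : BoolFn n), IsExtremal k h) ∧
    (∀ k : ℕ, 1 ≤ k → ∃ φ : BoolFn (2 ^ (k - 1) - 1), IsCompleteFn k φ) ∧
    -- the number of columns of the zero matrix of `h`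
    (∀ (k n : ℕ) (h : BoolFn n), 1 ≤ k → IsExtremal k h →
      (2 : ℝ) ^ (k - 1) * (1 - 2 / (k : ℝ)) ≤ n) ∧
    -- the explicit lower bound for `h`
    (∀ (k n : ℕ) (h : BoolFn n), 1 ≤ k →
      2 * √((k : ℝ) * Real.log k) / (k : ℝ) ≤ 1 / 4 → IsExtremal k h →
      (2 : ℝ) ^ (k - 1) *
          (10 / 3 - 5 / 3 * (2 * Real.log k / (√(k : ℝ) + 2 * Real.log k))) *
          (1 - 2 / (k : ℝ)) < minRank h) ∧
    -- the asymptotic lower bound for `h`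
    (∃ δ : ℕ → ℝ, Tendsto δ atTop (𝓝 0) ∧
      ∀ (k n : ℕ) (h : BoolFn n), 1 ≤ k → IsExtremal k h →
        10 / 3 * (2 : ℝ) ^ (k - 1) * (1 + δ k) < minRank h) ∧
    -- the upper bound for complete functions
    (∃ δ : ℕ → ℝ, Tendsto δ atTop (𝓝 0) ∧
      ∀ (k : ℕ) (φ : BoolFn (2 ^ (k - 1) - 1)), 1 ≤ k → IsCompleteFn k φ →
        (minRank φ : ℝ) ≤ 3 * (2 : ℝ) ^ (k - 1) * (1 + δ k)) ∧
    -- `h` is more complex than the complete function with the same number of zeros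
    (∀ c : ℝ, c < 10 / 9 → ∀ᶠ k : ℕ in atTop,
      ∀ (n : ℕ) (h : BoolFn n) (φ : BoolFn (2 ^ (k - 1) - 1)),
        IsExtremal k h → IsCompleteFn k φ → c * (minRank φ : ℝ) < minRank h) ∧
    -- the complete function is not the most complex one in its class, even asymptotically
    (∃ δ : ℕ → ℝ, Tendsto δ atTop (𝓝 0) ∧
      ∀ k : ℕ, 1 ≤ k → ∃ g ∈ zeroClass k (2 ^ (k - 1) - 1),
        10 / 3 * (2 : ℝ) ^ (k - 1) * (1 + δ k) < minRank g) ∧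
    (∀ c : ℝ, c < 10 / 9 → ∀ᶠ k : ℕ in atTop,
      ∃ g ∈ zeroClass k (2 ^ (k - 1) - 1), ∀ φ : BoolFn (2 ^ (k - 1) - 1),
        IsCompleteFn k φ → c * (minRank φ : ℝ) < minRank g) := by
  refine ⟨fun k hk => exists_isExtremal hk, fun k hk => exists_isCompleteFn hk,
    fun k n h hk hh => hh.le_card hk, fun k n h hk hc hh => hh.lt_minRank hk hc,
    exists_tendsto_lt_minRank_of_isExtremal, exists_tendsto_minRank_le_of_isCompleteFn,
    fun c hc => eventually_mul_minRank_lt hc, ?_, ?_⟩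
  · obtain ⟨δ, hδ, hlow⟩ := exists_tendsto_lt_minRank_of_isExtremal
    refine ⟨δ, hδ, fun k hk => ?_⟩
    obtain ⟨n, h, hh⟩ := exists_isExtremal hk
    obtain ⟨g, hg, hle⟩ := hh.exists_mem_zeroClass hk
    exact ⟨g, hg, (hlow k n h hk hh).trans_le (by exact_mod_cast hle)⟩
  · intro c hc
    filter_upwards [eventually_mul_minRank_lt hc, eventually_ge_atTop 1] with k hk hk1
    obtain ⟨n, h, hh⟩ := exists_isExtremal hk1
    obtain ⟨g, hg, hle⟩ := hh.exists_mem_zeroClass hk1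
    exact ⟨g, hg, fun φ hφ => (hk n h φ hh hφ).trans_le (by exact_mod_cast hle)⟩
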